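/- Let $d\ge 1$, $T=[0,1]$, $\mathcal X=[0,1]^d$. Let $(\phi,\psi)$ and $(\tilde\phi,\tilde\psi)$ be compactly supported orthonormal multiresolution systems (scaling function, wavelet) on $\mathbb R$, of class $C^{\tau_1}$ and $C^{\tau_2}$ respectively. Let $(\psi_\lambda)_{\lambda\in\Lambda}$ be the periodized tensor-product wavelet basis of $L^2(\mathcal X)$ built from $(\phi,\psi)$ with coarsest level $0$: there is one index at level $|\lambda|=-1$ (the scaling function), and the indices at level $|\lambda|=j\ge 0$ are the pairs $(e,k)$ with $e\in\{0,1\}^d\setminus\{0\}$ and $k\in\{0,\dots,2^j-1\}^d$. Let $(\tilde\psi_{m,\ell})$, $m\ge -1$, be the corresponding periodized basis of $L^2(T)$ built from $(\tilde\phi,\tilde\psi)$, with the single scaling function at level $m=-1$ and $\ell=0,\dots,2^m-1$ for $m\ge 0$. Let $0<s_1<\tau_1$, $0<s_2<\tau_2$ and $1\le p_1,q_1,p_2,q_2\le\infty$ with $s_1+d(1/2-1/p_1)>0$ and $s_2+1/2-1/p_2>0$. Let $A_1>0$, and let $(A_\lambda)_{\lambda\in\Lambda}$ be positive numbers for which there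 is a constant $A>0$ with $$A_\lambda\,2^{\frac d2(j+1)}\ge A\qquad\text{for all } j\ge -1 \text{ and all } \lambda \text{ with } |\lambda|=j .$$ Let $\mathbf B$ be the set of all $f\in L^2(T\times\mathcal X)$ with $f(t,\cdot)\in L^2(\mathcal X)$ for every $t\in T$ such that $$\sup_{t\in T}\Big(\sum_{j\ge-1}2^{j(s_1+d(1/2-1/p_1))q_1}\Big(\sum_{|\lambda|=j}|\langle f(t,\cdot),\psi_\lambda\rangle|^{p_1}\Big)^{q_1/p_1}\Big)^{1/q_1}\le A_1$$ and, for every $\lambda\in\Lambda$, with $\tilde\alpha_{\lambda,m,\ell}=\int_{T\times\mathcal X}f(t,x)\,\tilde\psi_{m,\ell}(t)\,\psi_\lambda(x)\,dt\,dx$, $$\Big(\sum_{m\ge-1}2^{m(s_2+1/2-1/p_2)q_2}\Big(\sum_{\ell}|\tilde\alpha_{\lambda,m,\ell}|^{p_2}\Big)^{q_2/p_2}\Big)^{1/q_2}\le A_\lambda$$ (sums are replaced by suprema for infinite exponents). For $\epsilon>0$, one observes $dY_\epsilon=f\,dt\,dx+\epsilon\,dW$ on $T\times\mathcal X$ with $W$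 a Gaussian white noise, that is, the random variables $\int g\,dY_\epsilon=\int gf\,dt\,dx+\epsilon\int g\,dW$ for all $g\in L^2(T\times\mathcal X)$, where $(\int g\,dW)_g$ is a centred Gaussian process with covariance $\int g_1g_2\,dt\,dx$. Let $\mathcal R_\epsilon(\mathbf B)=\inf_{\hat f}\sup_{f\in\mathbf B}\mathbb E\int_{T\times\mathcal X}|\hat f-f|^2\,dt\,dx$, the infimum being over all measurable estimators $\hat f$ based on this observation. Let $s>0$ be given by $\frac1s=\frac1{d+1}\big(\frac d{s_1}+\frac1{s_2}\big)$. Then there are $C>0$ and $\epsilon_0>0$, not depending on $\epsilon$, such that $$\mathcal R_\epsilon(\mathbf B)\ \ge\ C\,\epsilon^{\frac{4s}{2s+d+1}}\qquad\text{for all } 0<\epsilon<\epsilon_0 .$$ -/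

import Mathlib

open MeasureTheory ProbabilityTheory Set
open scoped ENNReal

noncomputable section

namespace SpaceTimeWavelet

/-! ### One-dimensional orthonormal wavelet systems -/

/-- The dilated and translated function `g_{j,k}(x) = 2^{j/2} g(2^j x - k)`. -/
def atom (g : ℝ → ℝ) (j : ℕ) (k : ℤ) (x : ℝ) : ℝ :=
  (2 : ℝ) ^ ((j : ℝ) / 2) * g (2 ^ j * x - k)

/-- The closed linear span in `L²(ℝ)` of the functions `g_{j,k}`, `k ∈ ℤ`. -/
def levelSpace (g : ℝ → ℝ) (j : ℕ) : Submodule ℝ (Lp ℝ 2 (volume : Measure ℝ)) :=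
  (Submodule.span ℝ
    {u : Lp ℝ 2 (volume : Measure ℝ) | ∃ k : ℤ, u =ᵐ[volume] atom g j k}).topologicalClosure

/-- `(φ, ψ)` is a compactly supported orthonormal wavelet system of regularity `τ`: the spaces
`V_j` spanned by the `φ_{j,k}` are a multiresolution hierarchy of `L²(ℝ)`, the integer translates
of `φ` (and of `ψ`) are orthonormal, and the `ψ_{j,k}` span the orthogonal complement `W_j` of
`V_j` in `V_{j+1}`. -/
structure IsWaveletSystem (τ : ℕ) (φ ψ : ℝ → ℝ) : Prop where
  contDiff_scaling : ContDiff ℝ τ φ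
  contDiff_wavelet : ContDiff ℝ τ ψ
  compact_scaling : HasCompactSupport φ
  compact_wavelet : HasCompactSupport ψ
  orthonormal_scaling : ∀ k l : ℤ, ∫ x, φ (x - k) * φ (x - l) = if k = l then 1 else 0
  orthonormal_wavelet : ∀ k l : ℤ, ∫ x, ψ (x - k) * ψ (x - l) = if k = l then 1 else 0
  nested : ∀ j, levelSpace φ j ≤ levelSpace φ (j + 1)
  dense : (⨆ j, levelSpace φ j).topologicalClosure = ⊤
  complement : ∀ j, levelSpace ψ j = (levelSpace φ j)ᗮ ⊓ levelSpace φ (j + 1)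

/-- The 1-periodic version `∑_{l ∈ ℤ} g_{j,k}(x + l)` of `g_{j,k}`. -/
def perAtom (g : ℝ → ℝ) (j : ℕ) (k : ℤ) (x : ℝ) : ℝ :=
  ∑' l : ℤ, atom g j k (x + l)

/-! ### Periodic wavelet bases in space and in time, with coarsest level `0` -/

/-- The indices `λ ∈ Λ` of the tensor-product basis of `L²([0,1]^d)`: the scaling function at the
coarsest level, and the wavelets at level `j ≥ 0` with orientation `e ∈ {0,1}^d \ {0}` and position
`k ∈ {0, …, 2^j - 1}^d`. -/
inductive SpaceIndex (d : ℕ) : Type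
  | scaling : SpaceIndex d
  | wavelet (j : ℕ) (e : {e : Fin d → Bool // ∃ i, e i = true}) (k : Fin d → Fin (2 ^ j)) :
      SpaceIndex d

/-- The level `|λ|`; the scaling function has level `-1`. -/
def SpaceIndex.level {d : ℕ} : SpaceIndex d → ℤ
  | .scaling => -1
  | .wavelet j _ _ => j

/-- The indices `(m, ℓ)` of the basis of `L²([0,1])`. -/
inductive TimeIndex : Type
  | scaling : TimeIndex
  | wavelet (m : ℕ) (l : Fin (2 ^ m)) : TimeIndex

/-- The level `m`; the scaling function has level `-1`. -/
def TimeIndex.level : TimeIndex → ℤ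
  | .scaling => -1
  | .wavelet m _ => m

/-- The periodic tensor-product basis function `ψ_λ`. -/
def spaceBasis {d : ℕ} (φ ψ : ℝ → ℝ) : SpaceIndex d → (Fin d → ℝ) → ℝ
  | .scaling, x => ∏ i, perAtom φ 0 0 (x i)
  | .wavelet j e k, x => ∏ i, perAtom (if e.1 i = true then ψ else φ) j (k i : ℕ) (x i)

/-- The periodic basis function `ψ̃_{m,ℓ}`. -/
def timeBasis (φ ψ : ℝ → ℝ) : TimeIndex → ℝ → ℝ
  | .scaling, t => perAtom φ 0 0 t
  | .wavelet m l, t => perAtom ψ m (l : ℕ) t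

/-! ### Besov norms and the space-time ball -/

/-- The `ℓ^p` norm of a family of extended nonnegative reals, `1 ≤ p ≤ ∞`. -/
def seqNorm {ι : Type*} (p : ℝ≥0∞) (a : ι → ℝ≥0∞) : ℝ≥0∞ :=
  if p = ⊤ then ⨆ i, a i else (∑' i, a i ^ p.toReal) ^ (p.toReal)⁻¹

/-- The Besov norm in dimension `d` of a family `a` of wavelet coefficients whose index set is
graded by `level`:
`(∑_{j ≥ -1} 2^{j (s + d (1/2 - 1/p)) q} (∑_{level i = j} |a i|^p)^{q/p})^{1/q}`, with suprema for
infinite `p` or `q`. The natural number `n` stands for the level `j = n - 1`. -/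
def besovNorm {ι : Type*} (level : ι → ℤ) (d : ℕ) (s : ℝ) (p q : ℝ≥0∞) (a : ι → ℝ) : ℝ≥0∞ :=
  seqNorm q fun n : ℕ =>
    ENNReal.ofReal ((2 : ℝ) ^ (((n : ℝ) - 1) * (s + d * (1 / 2 - (p⁻¹).toReal)))) *
      seqNorm p fun i : {i : ι // level i = (n : ℤ) - 1} => ‖a i.1‖ₑ

/-- Lebesgue measure on `[0,1]^d`. -/
def spaceMeasure (d : ℕ) : Measure (Fin d → ℝ) := volume.restrict (Icc 0 1)

/-- Lebesgue measure on `[0,1] × [0,1]^d`. -/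
def spaceTimeMeasure (d : ℕ) : Measure (ℝ × (Fin d → ℝ)) :=
  volume.restrict (Icc 0 1 ×ˢ Icc 0 1)

/-- `α_λ(t) = ∫ f(t,x) ψ_λ(x) dx`. -/
def spaceCoeff {d : ℕ} (φ ψ : ℝ → ℝ) (f : ℝ × (Fin d → ℝ) → ℝ) (t : ℝ) (i : SpaceIndex d) : ℝ :=
  ∫ x, f (t, x) * spaceBasis φ ψ i x ∂spaceMeasure d

/-- `α̃_{λ,m,ℓ} = ∫ f(t,x) ψ̃_{m,ℓ}(t) ψ_λ(x) dt dx`. -/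
def spaceTimeCoeff {d : ℕ} (φ ψ φ' ψ' : ℝ → ℝ) (f : ℝ × (Fin d → ℝ) → ℝ)
    (i : SpaceIndex d) (k : TimeIndex) : ℝ :=
  ∫ z, f z * timeBasis φ' ψ' k z.1 * spaceBasis φ ψ i z.2 ∂spaceTimeMeasure d

/-- The space-time Besov ball: all `f ∈ L²([0,1] × [0,1]^d)` such that `f(t,·)` lies in the spatial
Besov ball of radius `A₁` for every `t ∈ [0,1]` and, for every `λ`, the coefficient function `α_λ`
lies in the temporal Besov ball of radius `A_λ`. The spatial wavelet system is `(φ, ψ)`, the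
temporal one is `(φ', ψ')`. -/
def besovBall (d : ℕ) (φ ψ φ' ψ' : ℝ → ℝ) (s₁ s₂ : ℝ) (p₁ q₁ p₂ q₂ : ℝ≥0∞) (A₁ : ℝ)
    (Arad : SpaceIndex d → ℝ) : Set (ℝ × (Fin d → ℝ) → ℝ) :=
  {f | MemLp f 2 (spaceTimeMeasure d) ∧
    (∀ t ∈ Icc (0 : ℝ) 1, MemLp (fun x => f (t, x)) 2 (spaceMeasure d) ∧
      besovNorm SpaceIndex.level d s₁ p₁ q₁ (spaceCoeff φ ψ f t) ≤ ENNReal.ofReal A₁) ∧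
    ∀ i : SpaceIndex d,
      besovNorm TimeIndex.level 1 s₂ p₂ q₂ (spaceTimeCoeff φ ψ φ' ψ' f i) ≤
        ENNReal.ofReal (Arad i)}

/-! ### The white noise model and the minimax risk -/

/-- `W` is a Gaussian white noise on `[0,1] × [0,1]^d`: the variables `W g = ∫ g dW`,
`g ∈ L²([0,1] × [0,1]^d)`, form a centred Gaussian process with
`E (W g₁ * W g₂) = ∫ g₁ g₂ dt dx`. -/
structure IsWhiteNoise {Ω : Type*} [MeasurableSpace Ω] (P : Measure Ω) (d : ℕ)
    (W : Lp ℝ 2 (spaceTimeMeasure d) → Ω → ℝ) : Prop where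
  measurable : ∀ g, Measurable (W g)
  gaussian : IsGaussianProcess W P
  mean : ∀ g, ∫ ω, W g ω ∂P = 0
  covariance : ∀ g₁ g₂, ∫ ω, W g₁ ω * W g₂ ω ∂P = ∫ z, g₁ z * g₂ z ∂spaceTimeMeasure d

/-- The observation `∫ g dY = ∫ g f dt dx + ε ∫ g dW`, for all `g ∈ L²([0,1] × [0,1]^d)`. -/
def observation {Ω : Type*} {d : ℕ} (W : Lp ℝ 2 (spaceTimeMeasure d) → Ω → ℝ) (ε : ℝ)
    (f : ℝ × (Fin d → ℝ) → ℝ) (ω : Ω) : Lp ℝ 2 (spaceTimeMeasure d) → ℝ :=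
  fun g => (∫ z, g z * f z ∂spaceTimeMeasure d) + ε * W g ω

/-- The `L²`-risk `E ∫ |f̂(t,x) - f(t,x)|² dt dx` at `f` of the estimator `f̂`, a function of the
observation. -/
def risk {Ω : Type*} [MeasurableSpace Ω] (P : Measure Ω) {d : ℕ}
    (W : Lp ℝ 2 (spaceTimeMeasure d) → Ω → ℝ) (ε : ℝ)
    (est : (Lp ℝ 2 (spaceTimeMeasure d) → ℝ) → ℝ × (Fin d → ℝ) → ℝ)
    (f : ℝ × (Fin d → ℝ) → ℝ) : ℝ≥0∞ :=
  ∫⁻ ω, ∫⁻ z, ‖est (observation W ε f ω) z - f z‖ₑ ^ 2 ∂spaceTimeMeasure d ∂P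

/-- The minimax `L²`-risk over a class `B`: the infimum is over all estimators that are jointly
measurable in the observation (with the product σ-algebra) and the point `(t,x)`. -/
def minimaxRisk {Ω : Type*} [MeasurableSpace Ω] (P : Measure Ω) {d : ℕ}
    (W : Lp ℝ 2 (spaceTimeMeasure d) → Ω → ℝ) (ε : ℝ)
    (B : Set (ℝ × (Fin d → ℝ) → ℝ)) : ℝ≥0∞ :=
  ⨅ (est : (Lp ℝ 2 (spaceTimeMeasure d) → ℝ) → ℝ × (Fin d → ℝ) → ℝ)
    (_ : Measurable (Function.uncurry est)), ⨆ f ∈ B, risk P W ε est f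

end SpaceTimeWavelet

end

/-! The bound is Assouad's hypercube argument on one block of the tensor basis. Fix a spatial level
`j`, a temporal level `m` and the spatial orientation with a wavelet factor in every direction. The
products of the corresponding wavelets form an orthonormal system of `N = 2^{jd+m}` functions `h_p`;
the test signals are `γ ∑ θ_p h_p` with `θ_p ∈ {0,1}` and `γ = c ε`, `c ≤ 1`.

Testing. A change of one bit moves the signal by `γ h_p` with `γ ≤ ε`. Only the coordinate of the
noise along `h_p` sees it, and the rest of the noise is independent of that coordinate. After
division by `ε` the two laws of the coordinate are `N(0,1)` and `N(a,1)`, `a ≤ 1`, and both dominate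
the same multiple of the uniform law on `[0,1]`. Hence each bit costs at least a constant times `γ²`
(`IsWhiteNoise.two_point`). Bessel's inequality and averaging over the cube give a risk of order `γ²
N` (`IsWhiteNoise.hypercube_le_minimaxRisk`).

Membership (`sum_productWavelet_mem_besovBall`). At a fixed time there are `2^{jd}` spatial
coefficients, each of size at most `K γ 2^{m/2}`, because the temporal wavelets of one level overlap
boundedly. So the spatial norm is at most `2^{j(s₁+d/2)} K γ 2^{m/2}`; likewise each temporal norm
is at most `2^{m(s₂+1/2)} γ`, to be compared with `A_λ ≥ A 2^{-d(j+1)/2}`. The exponents `p` and `q`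
drop out.

Balance (`exists_balanced_levels`). With `ε = 2^E`, `j ≈ L/s₁` and `m ≈ L/s₂`, both constraints read
`L + (jd+m)/2 + E ≤ 0` up to constants. Equality determines `L`, and then `γ² N` is of order
`2^{-2L} = ε^{4s/(2s+d+1)}`. -/

namespace SpaceTimeWavelet

/-! ### A two-point bound for the white noise model -/

/-- A lower bound on `[0, 1]` for the densities of the laws `N(a, 1)`, `0 ≤ a ≤ 1`. -/
noncomputable def gaussianFloor : ℝ := (√(2 * Real.pi))⁻¹ * Real.exp (-1 / 2)

lemma gaussianFloor_pos : 0 < gaussianFloor := by unfold gaussianFloor; positivity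

lemma floor_le_gaussianReal {a : ℝ} (ha : a ∈ Icc (0 : ℝ) 1) :
    ENNReal.ofReal gaussianFloor • (volume.restrict (Icc (0 : ℝ) 1)) ≤ gaussianReal a 1 := by
  rw [gaussianReal_of_var_ne_zero a one_ne_zero, ← withDensity_const,
    ← withDensity_indicator measurableSet_Icc]
  refine withDensity_mono (ae_of_all _ fun x => ?_)
  by_cases hx : x ∈ Icc (0 : ℝ) 1
  · simp only [indicator_of_mem hx, gaussianPDF]
    refine ENNReal.ofReal_le_ofReal ?_
    simp only [gaussianPDFReal, gaussianFloor, NNReal.coe_one, mul_one]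
    refine mul_le_mul_of_nonneg_left (Real.exp_le_exp.2 ?_) (by positivity)
    obtain ⟨ha0, ha1⟩ := ha
    obtain ⟨hx0, hx1⟩ := hx
    have : (x - a) ^ 2 ≤ 1 := by rw [sq_le_one_iff_abs_le_one, abs_le]; constructor <;> linarith
    linarith
  · simp [indicator_of_notMem hx]

section TwoPoint

variable {Ω : Type*} [MeasurableSpace Ω] {P : Measure Ω} {d : ℕ}
  {W : Lp ℝ 2 (spaceTimeMeasure d) → Ω → ℝ}

lemma inner_eq_integral (g h : Lp ℝ 2 (spaceTimeMeasure d)) :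
    inner ℝ g h = ∫ z, g z * h z ∂spaceTimeMeasure d := by
  rw [L2.inner_def]
  simp [mul_comm]

lemma IsWhiteNoise.map_eq (hW : IsWhiteNoise P d W) {h : Lp ℝ 2 (spaceTimeMeasure d)}
    (hh : inner ℝ h h = 1) : P.map (W h) = gaussianReal 0 1 := by
  rw [(hW.gaussian.hasGaussianLaw_eval h).map_eq_gaussianReal, hW.mean]
  congr
  rw [variance_of_integral_eq_zero (hW.measurable h).aemeasurable (hW.mean h)]
  have := hW.covariance h h
  rw [← inner_eq_integral, hh] at this
  simp only [pow_two]
  simp [this]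

/-- The part of the white noise which is orthogonal to `h`. -/
noncomputable def residualNoise (W : Lp ℝ 2 (spaceTimeMeasure d) → Ω → ℝ)
    (h : Lp ℝ 2 (spaceTimeMeasure d)) (g : Lp ℝ 2 (spaceTimeMeasure d)) (ω : Ω) : ℝ :=
  W g ω - inner ℝ g h * W h ω

lemma IsWhiteNoise.measurable_residualNoise (hW : IsWhiteNoise P d W)
    (h g : Lp ℝ 2 (spaceTimeMeasure d)) : Measurable (residualNoise W h g) :=
  (hW.measurable g).sub ((hW.measurable h).const_mul _)

lemma IsWhiteNoise.memLp (hW : IsWhiteNoise P d W) (g : Lp ℝ 2 (spaceTimeMeasure d)) :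
    MemLp (W g) 2 P := (hW.gaussian.hasGaussianLaw_eval g).memLp_two

/-- The pair is jointly Gaussian, and subtracting the projection on `h` makes every covariance with
`W h` vanish; for Gaussian processes this is independence. -/
lemma IsWhiteNoise.indepFun_residualNoise (hW : IsWhiteNoise P d W)
    {h : Lp ℝ 2 (spaceTimeMeasure d)} (hh : inner ℝ h h = 1) :
    IndepFun (W h) (fun ω g => residualNoise W h g ω) P := by
  have := hW.gaussian.isProbabilityMeasure
  -- The single variable `W h` is viewed as a process indexed by `Unit`, to match the criterion for
  -- processes.
  have key : IndepFun (fun ω (_ : Unit) => W h ω) (fun ω g => residualNoise W h g ω) P := by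
    refine IsGaussianProcess.indepFun_of_covariance_eq_zero
      (X := fun (_ : Unit) ω => W h ω) (Y := residualNoise W h) ?_
      (fun _ => (hW.measurable h).aemeasurable)
      (fun g => (hW.measurable_residualNoise h g).aemeasurable) ?_
    · classical
      refine hW.gaussian.of_isGaussianProcess fun s => ?_
      rcases s with _ | g
      · exact ⟨{h}, .proj ⟨h, by simp⟩, fun ω => by simp⟩
      · exact ⟨{h, g}, .proj ⟨g, by simp⟩ - inner ℝ g h • .proj ⟨h, by simp⟩,
          fun ω => by simp [residualNoise]⟩
    · intro _ g
      have hc : ∀ g', cov[W h, W g'; P] = inner ℝ h g' := fun g' => by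
        rw [covariance_eq_sub (hW.memLp h) (hW.memLp g'), hW.mean, hW.mean, inner_eq_integral,
          ← hW.covariance]
        simp
      change cov[W h, W g - (fun ω => inner ℝ g h * W h ω); P] = 0
      rw [covariance_sub_right (hW.memLp h) (hW.memLp g) ((hW.memLp h).const_mul _),
        covariance_const_mul_right, hc, hc, hh, real_inner_comm]
      ring
  exact key.comp (φ := fun f : Unit → ℝ => f ()) (measurable_pi_apply ()) measurable_id

/-- The joint law of the shifted noise in the direction `h` and of the orthogonal part of the noise
dominates a multiple of the product of the uniform law on `[0, 1]` and the law of that part. -/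
lemma IsWhiteNoise.floor_le_lintegral (hW : IsWhiteNoise P d W)
    {h : Lp ℝ 2 (spaceTimeMeasure d)} (hh : inner ℝ h h = 1) {a : ℝ} (ha : a ∈ Icc (0 : ℝ) 1)
    {G : ℝ × (Lp ℝ 2 (spaceTimeMeasure d) → ℝ) → ℝ≥0∞} (hG : Measurable G) :
    ENNReal.ofReal gaussianFloor * ∫⁻ z, (∫⁻ x in Icc (0 : ℝ) 1, G (x, z))
      ∂P.map (fun ω g => residualNoise W h g ω) ≤
      ∫⁻ ω, G (W h ω + a, fun g => residualNoise W h g ω) ∂P := by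
  have := hW.gaussian.isProbabilityMeasure
  have hm1 : Measurable (fun ω => W h ω + a) := (hW.measurable h).add_const a
  have hm2 : Measurable (fun ω g => residualNoise W h g ω) :=
    measurable_pi_lambda _ (hW.measurable_residualNoise h)
  have hind : IndepFun (fun ω => W h ω + a) (fun ω g => residualNoise W h g ω) P :=
    (hW.indepFun_residualNoise hh).comp (φ := (· + a)) (measurable_id.add_const a) measurable_id
  have : IsProbabilityMeasure (P.map (fun ω g => residualNoise W h g ω)) :=
    Measure.isProbabilityMeasure_map hm2.aemeasurable
  have hmap : P.map (fun ω => W h ω + a) = gaussianReal a 1 := by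
    have h2 := gaussianReal_map_add_const (μ := 0) (v := 1) a
    rw [← hW.map_eq hh, Measure.map_map (measurable_add_const a) (hW.measurable h), zero_add] at h2
    exact h2
  rw [← lintegral_map (f := G) (g := fun ω => (W h ω + a, fun g => residualNoise W h g ω)) hG
    (hm1.prodMk hm2), (indepFun_iff_map_prod_eq_prod_map_map hm1.aemeasurable hm2.aemeasurable).1
    hind, hmap, lintegral_prod_symm' _ hG,
    ← lintegral_const_mul _ (Measurable.lintegral_prod_left' hG)]
  refine lintegral_mono fun z => ?_
  rw [← smul_eq_mul, ← lintegral_smul_measure]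
  exact lintegral_mono' (floor_le_gaussianReal ha) le_rfl

lemma enorm_sq_eq_ofReal (x : ℝ) : ‖x‖ₑ ^ 2 = ENNReal.ofReal (x ^ 2) := by
  rw [Real.enorm_eq_ofReal_abs, ← ENNReal.ofReal_pow (abs_nonneg _), sq_abs]

/-- The right side equals `((2t - γ)² + γ²) / 2`: no single guess `t` is close to both `0` and `γ`.
-/
lemma two_point_sq (t γ : ℝ) :
    ENNReal.ofReal (γ ^ 2 / 2) ≤ ‖t‖ₑ ^ 2 + ‖t - γ‖ₑ ^ 2 := by
  rw [enorm_sq_eq_ofReal, enorm_sq_eq_ofReal, ← ENNReal.ofReal_add (sq_nonneg _) (sq_nonneg _)]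
  exact ENNReal.ofReal_le_ofReal (by nlinarith [sq_nonneg (2 * t - γ)])

/-- The Bayes risk of testing between two signals that differ by `γ h`, where `h` is normalized and
`γ` does not exceed the noise level. -/
lemma IsWhiteNoise.two_point (hW : IsWhiteNoise P d W) {h : Lp ℝ 2 (spaceTimeMeasure d)}
    (hh : inner ℝ h h = 1) {γ ε : ℝ} (hε : 0 < ε) (hγ : 0 ≤ γ) (hγε : γ ≤ ε)
    (c : Lp ℝ 2 (spaceTimeMeasure d) → ℝ)
    {S : (Lp ℝ 2 (spaceTimeMeasure d) → ℝ) → ℝ} (hS : Measurable S) :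
    ENNReal.ofReal (gaussianFloor * γ ^ 2 / 2) ≤
      ∫⁻ ω, ‖S (fun g => c g + ε * W g ω)‖ₑ ^ 2 ∂P +
      ∫⁻ ω, ‖S (fun g => c g + γ * inner ℝ g h + ε * W g ω) - γ‖ₑ ^ 2 ∂P := by
  have := hW.gaussian.isProbabilityMeasure
  -- `Φ` rebuilds the observation from the noise coordinate along `h` and the residual. Feeding it
  -- `W h` gives the first hypothesis; feeding it `W h + γ / ε` gives the second.
  let Φ : ℝ × (Lp ℝ 2 (spaceTimeMeasure d) → ℝ) → Lp ℝ 2 (spaceTimeMeasure d) → ℝ :=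
    fun p g => c g + ε * (inner ℝ g h * p.1 + p.2 g)
  have hΦ : Measurable Φ := by
    refine measurable_pi_lambda _ fun g => ?_
    have : Measurable fun p : ℝ × (Lp ℝ 2 (spaceTimeMeasure d) → ℝ) => p.2 g :=
      (measurable_pi_apply g).comp measurable_snd
    exact ((((measurable_fst.const_mul _).add this).const_mul _).const_add _)
  have hG0 : Measurable fun p => ‖S (Φ p)‖ₑ ^ 2 := (hS.comp hΦ).enorm.pow_const 2
  have hG1 : Measurable fun p => ‖S (Φ p) - γ‖ₑ ^ 2 := ((hS.comp hΦ).sub_const γ).enorm.pow_const 2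
  have h0 := hW.floor_le_lintegral hh (a := 0) (by simp) hG0
  have h1 := hW.floor_le_lintegral hh (a := γ / ε)
    ⟨by positivity, (div_le_one hε).2 hγε⟩ hG1
  have e0 : ∀ ω, Φ (W h ω + 0, fun g => residualNoise W h g ω) = fun g => c g + ε * W g ω := by
    intro ω; ext g; simp only [Φ, residualNoise]; ring
  have e1 : ∀ ω, Φ (W h ω + γ / ε, fun g => residualNoise W h g ω) =
      fun g => c g + γ * inner ℝ g h + ε * W g ω := by
    intro ω; ext g; simp only [Φ, residualNoise]; field_simp; ring
  simp only [e0] at h0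
  simp only [e1] at h1
  refine le_trans ?_ (add_le_add h0 h1)
  have hm2 : Measurable (fun ω g => residualNoise W h g ω) :=
    measurable_pi_lambda _ (hW.measurable_residualNoise h)
  have : IsProbabilityMeasure (P.map (fun ω g => residualNoise W h g ω)) :=
    Measure.isProbabilityMeasure_map hm2.aemeasurable
  rw [← mul_add, ← lintegral_add_left (Measurable.lintegral_prod_left' hG0), mul_div_assoc,
    ENNReal.ofReal_mul gaussianFloor_pos.le]
  refine mul_le_mul_right ?_ _
  calc ENNReal.ofReal (γ ^ 2 / 2)
      = ∫⁻ z, (∫⁻ x in Icc (0 : ℝ) 1, ENNReal.ofReal (γ ^ 2 / 2))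
          ∂P.map (fun ω g => residualNoise W h g ω) := by simp
    _ ≤ _ := by
        refine lintegral_mono fun z => ?_
        rw [← lintegral_add_left (f := fun x => ‖S (Φ (x, z))‖ₑ ^ 2)
          (hG0.comp measurable_prodMk_right)]
        exact lintegral_mono fun x => two_point_sq _ _

end TwoPoint

/-! ### Bessel's inequality and the hypercube bound -/

section Bessel

variable {α : Type*} [MeasurableSpace α] {μ : Measure α} {κ : Type*} [DecidableEq κ]
  {h : κ → α → ℝ}

lemma orthonormal_toLp (hmem : ∀ k, MemLp (h k) 2 μ)
    (horth : ∀ k l, ∫ z, h k z * h l z ∂μ = if k = l then 1 else 0) :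
    Orthonormal ℝ fun k => (hmem k).toLp (h k) := by
  rw [orthonormal_iff_ite]
  intro k l
  rw [L2.inner_def, ← horth]
  refine integral_congr_ae ?_
  filter_upwards [(hmem k).coeFn_toLp, (hmem l).coeFn_toLp] with z hk hl
  simp [hk, hl, mul_comm]

/-- This is Bessel's inequality for `u - ∑ c_k h_k`. Square integrability of `u` is not assumed,
since an arbitrary estimator need not have it. -/
lemma sum_sq_coeff_sub_le [Fintype κ] (hmem : ∀ k, MemLp (h k) 2 μ)
    (horth : ∀ k l, ∫ z, h k z * h l z ∂μ = if k = l then 1 else 0)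
    {u : α → ℝ} (hu : AEStronglyMeasurable u μ) (c : κ → ℝ) :
    ∑ k, ‖(∫ z, u z * h k z ∂μ) - c k‖ₑ ^ 2 ≤ ∫⁻ z, ‖u z - ∑ k, c k * h k z‖ₑ ^ 2 ∂μ := by
  have hf : MemLp (fun z => ∑ k, c k * h k z) 2 μ :=
    memLp_finsetSum _ fun k _ => (hmem k).const_mul (c k)
  by_cases hv : MemLp (fun z => u z - ∑ k, c k * h k z) 2 μ
  · have hu2 : MemLp u 2 μ := by
      have := hv.add hf
      refine this.congr_norm hu (ae_of_all _ fun z => ?_)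
      simp
    have hint : ∀ {a b : α → ℝ}, MemLp a 2 μ → MemLp b 2 μ → Integrable (fun z => a z * b z) μ :=
      fun ha hb => ha.integrable_mul hb
    have hcoef : ∀ k, (∫ z, u z * h k z ∂μ) - c k =
        inner ℝ ((hmem k).toLp (h k)) (hv.toLp _) := by
      intro k
      have h1 : inner ℝ ((hmem k).toLp (h k)) (hv.toLp _) =
          ∫ z, (u z - ∑ k, c k * h k z) * h k z ∂μ := by
        rw [L2.inner_def]
        refine integral_congr_ae ?_
        filter_upwards [(hmem k).coeFn_toLp, hv.coeFn_toLp] with z hk hl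
        simp [hk, hl]
      have h2 : ∫ z, (∑ l, c l * h l z) * h k z ∂μ = c k := by
        simp only [Finset.sum_mul]
        rw [integral_finsetSum _ fun l _ => hint ((hmem l).const_mul (c l)) (hmem k)]
        simp only [mul_assoc, integral_const_mul, horth]
        simp
      rw [h1]
      simp only [sub_mul]
      rw [integral_sub (hint hu2 (hmem k)) (hint hf (hmem k)), h2]
    have hb := (orthonormal_toLp hmem horth).sum_inner_products_le (s := Finset.univ) (hv.toLp _)
    have hn : ∫⁻ z, ‖u z - ∑ k, c k * h k z‖ₑ ^ 2 ∂μ = ENNReal.ofReal (‖hv.toLp _‖ ^ 2) := by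
      rw [← real_inner_self_eq_norm_sq, L2.inner_def]
      have e : ∫ a, inner ℝ (hv.toLp _ a) (hv.toLp _ a) ∂μ =
          ∫ z, (u z - ∑ k, c k * h k z) ^ 2 ∂μ := by
        refine integral_congr_ae ?_
        filter_upwards [hv.coeFn_toLp] with z hz
        simp [hz, pow_two]
      rw [e, ofReal_integral_eq_lintegral_ofReal hv.integrable_sq
        (ae_of_all _ fun _ => sq_nonneg _)]
      simp only [enorm_sq_eq_ofReal]
    rw [hn]
    simp only [hcoef, enorm_sq_eq_ofReal]
    rw [← ENNReal.ofReal_sum_of_nonneg fun _ _ => sq_nonneg _]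
    refine ENNReal.ofReal_le_ofReal ?_
    simpa using hb
  -- If the difference is not in `L²`, the right side is infinite, whatever default values the
  -- integrals on the left take.
  · have : ∫⁻ z, ‖u z - ∑ k, c k * h k z‖ₑ ^ 2 ∂μ = ⊤ := by
      by_contra hne
      refine hv ⟨hu.sub hf.aestronglyMeasurable, ?_⟩
      rw [eLpNorm_lt_top_iff_lintegral_rpow_enorm_lt_top two_ne_zero ENNReal.ofNat_ne_top]
      simpa using lt_top_iff_ne_top.2 hne
    rw [this]; exact le_top

end Bessel

section Assouad

variable {Ω : Type*} [MeasurableSpace Ω] {P : Measure Ω} {d : ℕ}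
  {W : Lp ℝ 2 (spaceTimeMeasure d) → Ω → ℝ} {κ : Type*} [Fintype κ] [DecidableEq κ]
  {h : κ → ℝ × (Fin d → ℝ) → ℝ}

instance : IsFiniteMeasure (spaceMeasure d) := by
  unfold spaceMeasure
  exact ⟨by simpa using isCompact_Icc.measure_lt_top⟩

instance : IsFiniteMeasure (spaceTimeMeasure d) := by
  unfold spaceTimeMeasure
  exact ⟨by simpa using (isCompact_Icc.prod isCompact_Icc).measure_lt_top⟩

/-- Flipping bit `k` is an involution of the cube, so the second copy of the sum may be taken over
the flipped vertices. -/
lemma two_mul_sum_eq_sum_update (k : κ) (F : (κ → Bool) → ℝ≥0∞) :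
    2 * ∑ θ, F θ = ∑ θ, (F (Function.update θ k false) + F (Function.update θ k true)) := by
  have hinv : Function.Involutive fun θ : κ → Bool => Function.update θ k (!θ k) := by
    intro θ; ext l; by_cases hl : l = k
    · subst hl; simp
    · simp [hl]
  have := Equiv.sum_comp (Function.Involutive.toPerm _ hinv) F
  rw [two_mul]
  nth_rewrite 2 [← this]
  rw [← Finset.sum_add_distrib]
  refine Finset.sum_congr rfl fun θ _ => ?_
  simp only [Function.Involutive.coe_toPerm]
  cases hk : θ k
  · have : Function.update θ k false = θ := by rw [← hk]; simp
    simp [this]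
  · have : Function.update θ k true = θ := by rw [← hk]; simp
    simp [this, add_comm]

/-- The hypercube (Assouad) lower bound for the minimax risk over a class that contains all the
functions `γ ∑ θ_k h_k`, `θ_k ∈ {0, 1}`, where `(h_k)` is a finite orthonormal system. -/
theorem IsWhiteNoise.hypercube_le_minimaxRisk (hW : IsWhiteNoise P d W)
    (hmem : ∀ k, MemLp (h k) 2 (spaceTimeMeasure d)) (hmeas : ∀ k, Measurable (h k))
    (horth : ∀ k l, ∫ z, h k z * h l z ∂spaceTimeMeasure d = if k = l then 1 else 0)
    {γ ε : ℝ} (hε : 0 < ε) (hγ : 0 ≤ γ) (hγε : γ ≤ ε) {B : Set (ℝ × (Fin d → ℝ) → ℝ)}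
    (hB : ∀ θ : κ → Bool, (fun z => ∑ k, (if θ k then γ else 0) * h k z) ∈ B) :
    ENNReal.ofReal (gaussianFloor / 4 * γ ^ 2 * Fintype.card κ) ≤ minimaxRisk P W ε B := by
  have hP := hW.gaussian.isProbabilityMeasure
  refine le_iInf₂ fun est hest => ?_
  set f : (κ → Bool) → ℝ × (Fin d → ℝ) → ℝ :=
    fun θ z => ∑ k, (if θ k then γ else 0) * h k z with hf
  -- Only the coefficients of the estimator along the `h_k` matter; by Bessel their errors bound the
  -- risk from below.
  let S : κ → (Lp ℝ 2 (spaceTimeMeasure d) → ℝ) → ℝ :=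
    fun k y => ∫ z, est y z * h k z ∂spaceTimeMeasure d
  have hS : ∀ k, Measurable (S k) := fun k => by
    have : Measurable fun p : (Lp ℝ 2 (spaceTimeMeasure d) → ℝ) × (ℝ × (Fin d → ℝ)) =>
      est p.1 p.2 * h k p.2 := hest.mul ((hmeas k).comp measurable_snd)
    exact (this.stronglyMeasurable.integral_prod_right' (ν := spaceTimeMeasure d)).measurable
  let R : (κ → Bool) → κ → ℝ≥0∞ := fun θ k =>
    ∫⁻ ω, ‖S k (observation W ε (f θ) ω) - (if θ k then γ else 0)‖ₑ ^ 2 ∂P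
  have hobs : ∀ θ, Measurable fun ω => observation W ε (f θ) ω := fun θ =>
    measurable_pi_lambda _ fun g => ((hW.measurable g).const_mul ε).const_add _
  have hrisk : ∀ θ, ∑ k, R θ k ≤ risk P W ε est (f θ) := fun θ => by
    simp only [R, risk]
    rw [← lintegral_finsetSum]
    · refine lintegral_mono fun ω => ?_
      refine sum_sq_coeff_sub_le hmem horth ?_ _
      exact (hest.comp measurable_prodMk_left).aestronglyMeasurable
    · exact fun k _ => (((hS k).comp (hobs θ)).sub_const _).enorm.pow_const 2
  have hpair : ∀ θ k, ENNReal.ofReal (gaussianFloor * γ ^ 2 / 2) ≤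
      R (Function.update θ k false) k + R (Function.update θ k true) k := by
    intro θ k
    have hnorm : inner ℝ ((hmem k).toLp (h k)) ((hmem k).toLp (h k)) = (1 : ℝ) := by
      simpa using (orthonormal_iff_ite.1 (orthonormal_toLp hmem horth)) k k
    have key := hW.two_point hnorm hε hγ hγε
      (fun g => ∫ z, g z * f (Function.update θ k false) z ∂spaceTimeMeasure d) (hS k)
    have hstep : f (Function.update θ k true) =
        fun z => f (Function.update θ k false) z + γ * h k z := by
      ext z
      simp only [hf]
      rw [← Finset.sum_erase_add _ _ (Finset.mem_univ k),
        ← Finset.sum_erase_add (s := Finset.univ) (a := k) (f := fun l =>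
          (if Function.update θ k false l then γ else 0) * h l z) (Finset.mem_univ k)]
      simp only [Function.update_self, if_true, Bool.false_eq_true, if_false, zero_mul, add_zero]
      congr 1
      refine Finset.sum_congr rfl fun l hl => ?_
      simp [Finset.ne_of_mem_erase hl]
    have hmemf : MemLp (f (Function.update θ k false)) 2 (spaceTimeMeasure d) :=
      memLp_finsetSum _ fun l _ => (hmem l).const_mul _
    have hshift : ∀ g : Lp ℝ 2 (spaceTimeMeasure d),
        ∫ z, g z * f (Function.update θ k true) z ∂spaceTimeMeasure d =
        (∫ z, g z * f (Function.update θ k false) z ∂spaceTimeMeasure d) +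
          γ * inner ℝ g ((hmem k).toLp (h k)) := by
      intro g
      rw [hstep]
      have i1 : Integrable (fun z => g z * f (Function.update θ k false) z)
        (spaceTimeMeasure d) := (Lp.memLp g).integrable_mul hmemf
      have i2 : Integrable (fun z => g z * (γ * h k z)) (spaceTimeMeasure d) :=
        (Lp.memLp g).integrable_mul ((hmem k).const_mul γ)
      simp only [mul_add]
      rw [integral_add i1 i2, inner_eq_integral,
        ← integral_const_mul]
      congr 1
      refine integral_congr_ae ?_
      filter_upwards [(hmem k).coeFn_toLp] with z hz
      rw [hz]; ring
    have o0 : ∀ ω, observation W ε (f (Function.update θ k false)) ω = fun g =>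
      (∫ z, g z * f (Function.update θ k false) z ∂spaceTimeMeasure d) + ε * W g ω := fun ω => rfl
    have o1 : ∀ ω, observation W ε (f (Function.update θ k true)) ω = fun g =>
      (∫ z, g z * f (Function.update θ k false) z ∂spaceTimeMeasure d) +
        γ * inner ℝ g ((hmem k).toLp (h k)) + ε * W g ω := fun ω => by
      ext g; simp only [observation, hshift]
    simp only [R, o0, o1, Function.update_self, if_true, Bool.false_eq_true, if_false, sub_zero]
    exact key
  have hsup : ∀ θ, risk P W ε est (f θ) ≤ ⨆ g ∈ B, risk P W ε est g := fun θ =>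
    le_iSup₂ (f := fun g _ => risk P W ε est g) (f θ) (hB θ)
  set M := ⨆ g ∈ B, risk P W ε est g
  have hN : (Fintype.card (κ → Bool) : ℝ≥0∞) ≠ 0 := by simp
  -- The risks are summed over all vertices and the vertices paired along each edge direction; the
  -- number of vertices then cancels.
  have htotal : (Fintype.card (κ → Bool) : ℝ≥0∞) *
      (Fintype.card κ * ENNReal.ofReal (gaussianFloor * γ ^ 2 / 2)) ≤
      (Fintype.card (κ → Bool) : ℝ≥0∞) * (2 * M) := by
    calc (Fintype.card (κ → Bool) : ℝ≥0∞) *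
          (Fintype.card κ * ENNReal.ofReal (gaussianFloor * γ ^ 2 / 2))
        = ∑ _k : κ, ∑ _θ : κ → Bool, ENNReal.ofReal (gaussianFloor * γ ^ 2 / 2) := by
          simp only [Finset.sum_const, Finset.card_univ, nsmul_eq_mul]; ring
      _ ≤ ∑ k, ∑ θ, (R (Function.update θ k false) k + R (Function.update θ k true) k) :=
          Finset.sum_le_sum fun k _ => Finset.sum_le_sum fun θ _ => hpair θ k
      _ = ∑ k, 2 * ∑ θ, R θ k :=
          Finset.sum_congr rfl fun k _ => (two_mul_sum_eq_sum_update k fun θ => R θ k).symm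
      _ = 2 * ∑ θ, ∑ k, R θ k := by rw [← Finset.mul_sum, Finset.sum_comm]
      _ ≤ 2 * ∑ _θ : κ → Bool, M :=
          mul_le_mul_right (Finset.sum_le_sum fun θ _ => (hrisk θ).trans (hsup θ)) _
      _ = _ := by simp only [Finset.sum_const, Finset.card_univ, nsmul_eq_mul]; ring
  rw [ENNReal.mul_le_mul_iff_right hN (ENNReal.natCast_ne_top _)] at htotal
  have e : ENNReal.ofReal (gaussianFloor / 4 * γ ^ 2 * Fintype.card κ) * 2 =
      Fintype.card κ * ENNReal.ofReal (gaussianFloor * γ ^ 2 / 2) := by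
    have h2 : (2 : ℝ≥0∞) = ENNReal.ofReal 2 := by simp
    have hc : (Fintype.card κ : ℝ≥0∞) = ENNReal.ofReal (Fintype.card κ) := by simp
    rw [h2, hc, ← ENNReal.ofReal_mul' (by norm_num), ← ENNReal.ofReal_mul (by positivity)]
    congr 1; ring
  rw [← e, mul_comm 2 M] at htotal
  rwa [ENNReal.mul_le_mul_iff_left two_ne_zero ENNReal.ofNat_ne_top] at htotal

end Assouad

/-! ### Periodization -/

/-- The 1-periodic version of `u`. -/
noncomputable def per (u : ℝ → ℝ) (x : ℝ) : ℝ := ∑' l : ℤ, u (x + l)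

/-- `u` vanishes outside `(-M, M)`. -/
def VanishesOff (u : ℝ → ℝ) (M : ℕ) : Prop := ∀ x, (M : ℝ) ≤ |x| → u x = 0

lemma exists_vanishesOff {u : ℝ → ℝ} (hu : HasCompactSupport u) : ∃ M, VanishesOff u M := by
  obtain ⟨R, hR⟩ := hu.isCompact.isBounded.subset_ball 0
  obtain ⟨M, hM⟩ := exists_nat_ge R
  refine ⟨M, fun x hx => by_contra fun hne => ?_⟩
  have := hR (subset_tsupport _ hne)
  rw [Metric.mem_ball, dist_zero_right, Real.norm_eq_abs] at this
  linarith

lemma VanishesOff.hasCompactSupport {u : ℝ → ℝ} {M : ℕ} (hu : VanishesOff u M) :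
    HasCompactSupport u := by
  refine HasCompactSupport.intro (isCompact_Icc (a := -(M : ℝ)) (b := M)) fun x hx => hu x ?_
  by_contra hlt
  exact hx (abs_le.1 (not_le.1 hlt).le)

lemma VanishesOff.shift_eq_zero {u : ℝ → ℝ} {M : ℕ} (hu : VanishesOff u M) {K : ℕ} {x : ℝ}
    (hx : |x| ≤ K) {l : ℤ} (hl : l ∉ Finset.Icc (-(K + M : ℤ)) (K + M)) : u (x + l) = 0 := by
  refine hu _ ?_
  have hl' : (K + M : ℝ) ≤ |(l : ℝ)| := by
    have : (K + M : ℤ) ≤ |l| := by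
      by_contra hlt
      exact hl (Finset.mem_Icc.2 (abs_le.1 (not_le.1 hlt).le))
    exact_mod_cast this
  have := abs_sub_abs_le_abs_sub (l : ℝ) (-x)
  rw [abs_neg, sub_neg_eq_add, add_comm (l : ℝ)] at this
  linarith

/-- The same finite set of translates serves every `|x| ≤ K`, so continuity and integrals of `per u`
reduce to finite sums. -/
lemma VanishesOff.per_eq_sum {u : ℝ → ℝ} {M : ℕ} (hu : VanishesOff u M) {K : ℕ} {x : ℝ}
    (hx : |x| ≤ K) : per u x = ∑ l ∈ Finset.Icc (-(K + M : ℤ)) (K + M), u (x + l) :=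
  tsum_eq_sum fun _ hl => hu.shift_eq_zero hx hl

lemma VanishesOff.continuous_per {u : ℝ → ℝ} {M : ℕ} (hu : VanishesOff u M) (hc : Continuous u) :
    Continuous (per u) := by
  rw [continuous_iff_continuousAt]
  intro x
  obtain ⟨K, hK⟩ := exists_nat_gt |x|
  have hev : (fun x => ∑ l ∈ Finset.Icc (-(K + M : ℤ)) (K + M), u (x + l)) =ᶠ[nhds x] per u := by
    filter_upwards [(isOpen_lt continuous_abs continuous_const).mem_nhds hK] with y hy
    exact (hu.per_eq_sum (le_of_lt hy)).symm
  refine ContinuousAt.congr (Continuous.continuousAt ?_) hev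
  fun_prop

lemma per_add_int (u : ℝ → ℝ) (x : ℝ) (n : ℤ) : per u (x + n) = per u x := by
  unfold per
  rw [← (Equiv.addLeft n).tsum_eq fun l : ℤ => u (x + l)]
  simp [add_assoc]

/-- The integral of a product of periodizations over a period, when the nontrivial translates do
not contribute. -/
lemma setIntegral_per_mul_per {u v : ℝ → ℝ} {M N : ℕ} (hu : VanishesOff u M)
    (hv : VanishesOff v N) (huc : Continuous u) (hvc : Continuous v)
    (h0 : ∀ l : ℤ, l ≠ 0 → ∫ x, u x * v (x + l) = 0) :
    ∫ x in Icc (0 : ℝ) 1, per u x * per v x = ∫ x, u x * v x := by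
  have hV := hv.continuous_per hvc
  have hint : ∀ {w : ℝ → ℝ}, Continuous w → Integrable fun x => u x * w x := fun hw =>
    (huc.mul hw).integrable_of_hasCompactSupport hu.hasCompactSupport.mul_right
  -- Unfold `per v` first: on the support of `u` it is a finite sum, of which only the term `l = 0`
  -- survives integration.
  have h1 : ∫ x, u x * per v x = ∫ x, u x * v x := by
    have e : ∀ x, u x * per v x =
        ∑ l ∈ Finset.Icc (-(M + N : ℤ)) (M + N), u x * v (x + l) := fun x => by
      rcases le_total (M : ℝ) |x| with hx | hx
      · simp [hu x hx]
      · rw [hv.per_eq_sum hx, Finset.mul_sum]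
    simp only [e]
    have hi : ∀ l ∈ Finset.Icc (-(M + N : ℤ)) (M + N), Integrable fun x => u x * v (x + l) :=
      fun l _ => hint (by fun_prop)
    rw [integral_finsetSum _ hi,
      Finset.sum_eq_single 0 (fun l _ hl => h0 l hl)
        (fun hn => absurd (Finset.mem_Icc.2 ⟨by omega, by omega⟩) hn)]
    simp
  -- Cut the line into unit intervals; since `per v` is 1-periodic, the pieces reassemble into `per
  -- u * per v` on `[0,1]`.
  have h2 := (hint hV).hasSum_intervalIntegral_comp_add_int
  simp only [per_add_int] at h2
  have h3 : ∀ x ∈ uIcc (0 : ℝ) 1, |x| ≤ (1 : ℕ) := fun x hx => by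
    rw [uIcc_of_le zero_le_one] at hx
    rw [abs_of_nonneg hx.1]; simpa using hx.2
  have h4 : ∫ x, u x * per v x = ∑ l ∈ Finset.Icc (-((1 : ℕ) + M : ℤ)) ((1 : ℕ) + M),
      ∫ x in (0 : ℝ)..1, u (x + l) * per v x := by
    rw [← h2.tsum_eq]
    refine tsum_eq_sum fun l hl => ?_
    rw [intervalIntegral.integral_congr (g := fun _ => 0) fun x hx => by
      simp [hu.shift_eq_zero (h3 x hx) hl]]
    simp
  rw [← h1, h4, ← intervalIntegral.integral_finsetSum fun l _ =>
      Continuous.intervalIntegrable (by fun_prop) _ _,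
    integral_Icc_eq_integral_Ioc, ← intervalIntegral.integral_of_le zero_le_one]
  refine intervalIntegral.integral_congr fun x hx => ?_
  simp only [hu.per_eq_sum (h3 x hx), Finset.sum_mul]

/-! ### Orthogonality of wavelets on the line -/

lemma perAtom_eq_per (g : ℝ → ℝ) (j : ℕ) (k : ℤ) : perAtom g j k = per (atom g j k) := rfl

/-- An integer translate of an atom is an atom of the same level, so orthogonality on the line
passes to the periodized functions. -/
lemma atom_add_int (g : ℝ → ℝ) (j : ℕ) (k l : ℤ) (x : ℝ) :
    atom g j k (x + l) = atom g j (k - 2 ^ j * l) x := by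
  simp only [atom]; push_cast; ring_nf

lemma continuous_atom {g : ℝ → ℝ} (hg : Continuous g) (j : ℕ) (k : ℤ) :
    Continuous (atom g j k) := by unfold atom; fun_prop

lemma VanishesOff.atom {g : ℝ → ℝ} {M : ℕ} (hg : VanishesOff g M) (j : ℕ) (k : ℤ) :
    VanishesOff (atom g j k) (M + k.natAbs) := by
  intro x hx
  have : g (2 ^ j * x - k) = 0 := by
    refine hg _ ?_
    have h1 := abs_sub_abs_le_abs_sub ((2 : ℝ) ^ j * x) k
    have h2 : |x| ≤ |(2 : ℝ) ^ j * x| := by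
      rw [abs_mul, abs_of_pos (by positivity : (0 : ℝ) < 2 ^ j)]
      exact le_mul_of_one_le_left (abs_nonneg _) (one_le_pow₀ one_le_two)
    have h3 : (k.natAbs : ℝ) = |(k : ℝ)| := by rw [Nat.cast_natAbs, Int.cast_abs]
    push_cast at hx
    rw [h3] at hx
    linarith
  simp [SpaceTimeWavelet.atom, this]

lemma memLp_atom {g : ℝ → ℝ} (hg : Continuous g) (hs : HasCompactSupport g) (j : ℕ) (k : ℤ) :
    MemLp (atom g j k) 2 volume := by
  obtain ⟨M, hM⟩ := exists_vanishesOff hs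
  exact (continuous_atom hg j k).memLp_of_hasCompactSupport (hM.atom j k).hasCompactSupport

lemma toLp_atom_mem_levelSpace {g : ℝ → ℝ} (hg : Continuous g) (hs : HasCompactSupport g) (j : ℕ)
    (k : ℤ) : (memLp_atom hg hs j k).toLp _ ∈ levelSpace g j :=
  Submodule.le_topologicalClosure _ (Submodule.subset_span ⟨k, (memLp_atom hg hs j k).coeFn_toLp⟩)

lemma inner_toLp_eq_integral {u v : ℝ → ℝ} (hu : MemLp u 2 volume) (hv : MemLp v 2 volume) :
    inner ℝ (hu.toLp u) (hv.toLp v) = ∫ x, u x * v x := by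
  rw [L2.inner_def]
  refine integral_congr_ae ?_
  filter_upwards [hu.coeFn_toLp, hv.coeFn_toLp] with x h1 h2
  simp [h1, h2, mul_comm]

namespace IsWaveletSystem

variable {τ : ℕ} {φ ψ : ℝ → ℝ}

lemma continuous_scaling (h : IsWaveletSystem τ φ ψ) : Continuous φ := h.contDiff_scaling.continuous

lemma continuous_wavelet (h : IsWaveletSystem τ φ ψ) : Continuous ψ := h.contDiff_wavelet.continuous

lemma levelSpace_mono (h : IsWaveletSystem τ φ ψ) : Monotone (levelSpace φ) :=
  monotone_nat_of_le_succ h.nested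

/-- `ψ_{j,k}` lies in `W_j`, which is orthogonal to `V_j`. -/
lemma integral_mul_wavelet_eq_zero (h : IsWaveletSystem τ φ ψ) {u : ℝ → ℝ}
    (hu : MemLp u 2 volume) {j : ℕ} (hmem : hu.toLp u ∈ levelSpace φ j) (k : ℤ) :
    ∫ x, u x * atom ψ j k x = 0 := by
  have h1 := toLp_atom_mem_levelSpace h.continuous_wavelet h.compact_wavelet j k
  rw [h.complement j] at h1
  rw [← inner_toLp_eq_integral hu (memLp_atom h.continuous_wavelet h.compact_wavelet j k)]
  exact h1.1 _ hmem

lemma integral_scaling_mul_wavelet (h : IsWaveletSystem τ φ ψ) {i j : ℕ} (hij : i ≤ j) (l k : ℤ) :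
    ∫ x, atom φ i l x * atom ψ j k x = 0 :=
  h.integral_mul_wavelet_eq_zero (memLp_atom h.continuous_scaling h.compact_scaling i l)
    (h.levelSpace_mono hij (toLp_atom_mem_levelSpace h.continuous_scaling h.compact_scaling i l)) k

/-- The coarser wavelet lies in `W_i ⊆ V_{i+1} ⊆ V_j`. -/
lemma integral_wavelet_mul_wavelet_of_lt (h : IsWaveletSystem τ φ ψ) {i j : ℕ}
    (hij : i < j) (l k : ℤ) :
    ∫ x, atom ψ i l x * atom ψ j k x = 0 := by
  have h1 := toLp_atom_mem_levelSpace h.continuous_wavelet h.compact_wavelet i l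
  rw [h.complement i] at h1
  exact h.integral_mul_wavelet_eq_zero (memLp_atom h.continuous_wavelet h.compact_wavelet i l)
    (h.levelSpace_mono hij h1.2) k

lemma integral_wavelet_mul_wavelet_of_ne (h : IsWaveletSystem τ φ ψ) {i j : ℕ}
    (hij : i ≠ j) (l k : ℤ) :
    ∫ x, atom ψ i l x * atom ψ j k x = 0 := by
  rcases lt_or_gt_of_ne hij with hlt | hlt
  · exact h.integral_wavelet_mul_wavelet_of_lt hlt l k
  · simp only [mul_comm (atom ψ i l _)]
    exact h.integral_wavelet_mul_wavelet_of_lt hlt k l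

lemma integral_wavelet_mul_wavelet (h : IsWaveletSystem τ φ ψ) (j : ℕ) (k l : ℤ) :
    ∫ x, atom ψ j k x * atom ψ j l x = if k = l then 1 else 0 := by
  have e : ∀ x, atom ψ j k x * atom ψ j l x =
      2 ^ j * (fun y => ψ (y - k) * ψ (y - l)) (2 ^ j * x) := fun x => by
    simp only [atom]
    have : (2 : ℝ) ^ ((j : ℝ) / 2) * (2 : ℝ) ^ ((j : ℝ) / 2) = 2 ^ j := by
      rw [← Real.rpow_add two_pos, add_halves, Real.rpow_natCast]
    rw [← this]; ring
  simp only [e]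
  rw [integral_const_mul, Measure.integral_comp_mul_left (fun y => ψ (y - k) * ψ (y - l)),
    h.orthonormal_wavelet,
    abs_of_pos (by positivity), smul_eq_mul, ← mul_assoc, mul_inv_cancel₀ (by positivity), one_mul]

lemma per_scaling_mul_wavelet (h : IsWaveletSystem τ φ ψ) {i j : ℕ} (hij : i ≤ j) (l k : ℤ) :
    ∫ x in Icc (0 : ℝ) 1, perAtom φ i l x * perAtom ψ j k x = 0 := by
  obtain ⟨M, hM⟩ := exists_vanishesOff h.compact_scaling
  obtain ⟨N, hN⟩ := exists_vanishesOff h.compact_wavelet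
  rw [perAtom_eq_per, perAtom_eq_per, setIntegral_per_mul_per (hM.atom i l) (hN.atom j k)
    (continuous_atom h.continuous_scaling i l) (continuous_atom h.continuous_wavelet j k)]
  · exact h.integral_scaling_mul_wavelet hij l k
  · intro n _
    simp only [atom_add_int]
    exact h.integral_scaling_mul_wavelet hij l _

lemma per_wavelet_mul_wavelet_of_ne (h : IsWaveletSystem τ φ ψ) {i j : ℕ}
    (hij : i ≠ j) (l k : ℤ) :
    ∫ x in Icc (0 : ℝ) 1, perAtom ψ i l x * perAtom ψ j k x = 0 := by
  obtain ⟨N, hN⟩ := exists_vanishesOff h.compact_wavelet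
  rw [perAtom_eq_per, perAtom_eq_per, setIntegral_per_mul_per (hN.atom i l) (hN.atom j k)
    (continuous_atom h.continuous_wavelet i l) (continuous_atom h.continuous_wavelet j k)]
  · exact h.integral_wavelet_mul_wavelet_of_ne hij l k
  · intro n _
    simp only [atom_add_int]
    exact h.integral_wavelet_mul_wavelet_of_ne hij l _

lemma per_wavelet_mul_wavelet (h : IsWaveletSystem τ φ ψ) (j : ℕ) (k l : Fin (2 ^ j)) :
    ∫ x in Icc (0 : ℝ) 1, perAtom ψ j (k : ℕ) x * perAtom ψ j (l : ℕ) x =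
      if k = l then 1 else 0 := by
  obtain ⟨N, hN⟩ := exists_vanishesOff h.compact_wavelet
  rw [perAtom_eq_per, perAtom_eq_per, setIntegral_per_mul_per (hN.atom j _) (hN.atom j _)
    (continuous_atom h.continuous_wavelet j _) (continuous_atom h.continuous_wavelet j _)]
  · rw [h.integral_wavelet_mul_wavelet]
    simp [Fin.ext_iff]
  · intro n hn
    simp only [atom_add_int]
    rw [h.integral_wavelet_mul_wavelet, if_neg]
    -- A nonzero multiple of `2^j` cannot be the difference of two positions in `{0, …, 2^j - 1}`.
    intro he
    have hk : ((k : ℕ) : ℤ) < 2 ^ j := by exact_mod_cast k.2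
    have hl : ((l : ℕ) : ℤ) < 2 ^ j := by exact_mod_cast l.2
    rcases lt_or_gt_of_ne hn with h1 | h1 <;> nlinarith

end IsWaveletSystem

/-! ### Sup-norm bounds -/

lemma continuous_perAtom {g : ℝ → ℝ} (hg : Continuous g) (hs : HasCompactSupport g) (j : ℕ)
    (k : ℤ) : Continuous (perAtom g j k) := by
  obtain ⟨M, hM⟩ := exists_vanishesOff hs
  exact (hM.atom j k).continuous_per (continuous_atom hg j k)

/-- At most `2M + 1` integers `k` satisfy `|x + k| < M`. -/
lemma VanishesOff.sum_abs_shift_le {g : ℝ → ℝ} {M : ℕ} (hg : VanishesOff g M) {D : ℝ}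
    (hD : ∀ x, |g x| ≤ D) (x : ℝ) (T : Finset ℤ) :
    ∑ k ∈ T, |g (x + k)| ≤ (2 * M + 1) * D := by
  have hD0 : 0 ≤ D := (abs_nonneg _).trans (hD 0)
  have h1 : ∑ k ∈ T, |g (x + k)| ≤ ∑ k ∈ Finset.Icc ⌈-M - x⌉ ⌊M - x⌋, |g (x + k)| := by
    rw [← Finset.sum_filter_ne_zero]
    refine Finset.sum_le_sum_of_subset_of_nonneg (fun k hk => ?_) fun _ _ _ => abs_nonneg _
    replace hk := (Finset.mem_filter.1 hk).2
    have hlt : |x + k| < M := by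
      by_contra hge
      exact hk (by simp [hg _ (not_lt.1 hge)])
    rw [abs_lt] at hlt
    rw [Finset.mem_Icc, Int.ceil_le, Int.le_floor]
    constructor <;> linarith
  refine h1.trans ((Finset.sum_le_sum (g := fun _ => D) fun k _ => hD _).trans ?_)
  rw [Finset.sum_const, nsmul_eq_mul, Int.card_Icc]
  refine mul_le_mul_of_nonneg_right ?_ hD0
  have h2 : ⌊(M : ℝ) - x⌋ + 1 - ⌈-(M : ℝ) - x⌉ ≤ 2 * M + 1 := by
    have a := Int.floor_le ((M : ℝ) - x)
    have b := Int.le_ceil (-(M : ℝ) - x)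
    have : ((⌊(M : ℝ) - x⌋ + 1 - ⌈-(M : ℝ) - x⌉ : ℤ) : ℝ) ≤ ((2 * M + 1 : ℤ) : ℝ) := by
      push_cast; linarith
    exact_mod_cast this
  have h3 : (⌊(M : ℝ) - x⌋ + 1 - ⌈-(M : ℝ) - x⌉).toNat ≤ 2 * M + 1 := by omega
  exact_mod_cast h3

/-- The periodized functions of one level have a sum of absolute values of order `2^{m/2}`. -/
lemma exists_sum_abs_perAtom_le {g : ℝ → ℝ} (hg : Continuous g) (hs : HasCompactSupport g) :
    ∃ K : ℝ, 0 < K ∧ ∀ (m : ℕ) (t : ℝ),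
      ∑ l : Fin (2 ^ m), |perAtom g m (l : ℕ) t| ≤ K * (2 : ℝ) ^ ((m : ℝ) / 2) := by
  obtain ⟨M, hM⟩ := exists_vanishesOff hs
  obtain ⟨D, hD⟩ := hg.bounded_above_of_compact_support hs
  have hD' : ∀ x, |g x| ≤ D := hD
  have hD0 : 0 ≤ D := (abs_nonneg _).trans (hD' 0)
  -- The extra `1` keeps the constant positive when `D = 0`.
  refine ⟨(2 * M + 1) * D + 1, by positivity, fun m t => ?_⟩
  obtain ⟨R, hR⟩ := exists_nat_ge |t|
  set S : Finset ℤ := Finset.Icc (-(R + (M + 2 ^ m : ℕ) : ℤ)) (R + (M + 2 ^ m : ℕ)) with hSdef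
  have hper : ∀ l : Fin (2 ^ m), perAtom g m (l : ℕ) t =
      ∑ n ∈ S, (2 : ℝ) ^ ((m : ℝ) / 2) * g (2 ^ m * t + ((2 ^ m * n - (l : ℕ) : ℤ) : ℝ)) := by
    intro l
    have hv : VanishesOff (atom g m (l : ℕ)) (M + 2 ^ m) := fun x hx =>
      hM.atom m (l : ℕ) x (le_trans (by
        have := l.2.le
        simp only [Int.natAbs_natCast]
        exact_mod_cast Nat.add_le_add_left this M) hx)
    rw [perAtom_eq_per, hv.per_eq_sum hR]
    refine Finset.sum_congr rfl fun n _ => ?_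
    simp only [atom]; push_cast; ring_nf
  -- By uniqueness of division with remainder, the double sum over positions and periods runs over
  -- distinct integer translates of `g`.
  have hinj : Set.InjOn (fun p : Fin (2 ^ m) × ℤ => (2 ^ m * p.2 - (p.1 : ℕ) : ℤ))
      (Finset.univ ×ˢ S : Finset (Fin (2 ^ m) × ℤ)) := by
    rintro ⟨a, n⟩ _ ⟨b, n'⟩ _ he
    simp only at he
    have ha : ((a : ℕ) : ℤ) < 2 ^ m := by exact_mod_cast a.2
    have hb : ((b : ℕ) : ℤ) < 2 ^ m := by exact_mod_cast b.2
    have hn : n = n' := by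
      rcases lt_trichotomy n n' with h1 | h1 | h1
      · nlinarith
      · exact h1
      · nlinarith
    subst hn
    have : ((a : ℕ) : ℤ) = (b : ℕ) := by linarith
    simp only [Prod.mk.injEq, and_true]
    exact Fin.ext (by exact_mod_cast this)
  have h2 : (0 : ℝ) < (2 : ℝ) ^ ((m : ℝ) / 2) := by positivity
  calc ∑ l : Fin (2 ^ m), |perAtom g m (l : ℕ) t|
      ≤ ∑ l : Fin (2 ^ m), ∑ n ∈ S, (2 : ℝ) ^ ((m : ℝ) / 2) *
          |g (2 ^ m * t + ((2 ^ m * n - (l : ℕ) : ℤ) : ℝ))| := by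
        refine Finset.sum_le_sum fun l _ => ?_
        rw [hper]
        refine (Finset.abs_sum_le_sum_abs _ _).trans (Finset.sum_le_sum fun n _ => ?_)
        rw [abs_mul, abs_of_pos h2]
    _ = (2 : ℝ) ^ ((m : ℝ) / 2) * ∑ k ∈ (Finset.univ ×ˢ S : Finset (Fin (2 ^ m) × ℤ)).image
          (fun p => (2 ^ m * p.2 - (p.1 : ℕ) : ℤ)), |g (2 ^ m * t + (k : ℝ))| := by
        rw [Finset.sum_image hinj, Finset.sum_product]
        simp only [Finset.mul_sum]
    _ ≤ (2 : ℝ) ^ ((m : ℝ) / 2) * ((2 * M + 1) * D) :=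
        mul_le_mul_of_nonneg_left (hM.sum_abs_shift_le hD' _ _) h2.le
    _ ≤ _ := by nlinarith

/-! ### Orthogonality of the tensor-product bases -/

lemma spaceMeasure_eq_pi (d : ℕ) :
    spaceMeasure d = Measure.pi fun _ : Fin d => volume.restrict (Icc (0 : ℝ) 1) := by
  rw [spaceMeasure, ← pi_univ_Icc, volume_pi, Measure.restrict_pi_pi]
  rfl

lemma spaceTimeMeasure_eq_prod (d : ℕ) :
    spaceTimeMeasure d = (volume.restrict (Icc (0 : ℝ) 1)).prod (spaceMeasure d) := by
  rw [spaceTimeMeasure, spaceMeasure, Measure.prod_restrict, Measure.volume_eq_prod]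

section Orthogonality

variable {d τ : ℕ} {φ ψ : ℝ → ℝ}

lemma integral_prod_mul_prod (u v : Fin d → ℝ → ℝ) :
    ∫ x, (∏ i, u i (x i)) * ∏ i, v i (x i) ∂spaceMeasure d =
      ∏ i, ∫ x in Icc (0 : ℝ) 1, u i x * v i x := by
  rw [spaceMeasure_eq_pi, ← integral_fintype_prod_eq_prod]
  simp only [Finset.prod_mul_distrib]

/-- The orientation of the wavelets with all factors equal to `ψ`. -/
def IsFull (e : {e : Fin d → Bool // ∃ i, e i = true}) : Prop := ∀ i, e.1 i = true

lemma IsFull.spaceBasis_eq {e : {e : Fin d → Bool // ∃ i, e i = true}} (he : IsFull e) (j : ℕ)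
    (k : Fin d → Fin (2 ^ j)) (x : Fin d → ℝ) :
    spaceBasis φ ψ (.wavelet j e k) x = ∏ i, perAtom ψ j (k i : ℕ) (x i) := by
  simp [spaceBasis, he _]

lemma IsWaveletSystem.integral_full_mul_self (h : IsWaveletSystem τ φ ψ)
    {e : {e : Fin d → Bool // ∃ i, e i = true}} (he : IsFull e) (j : ℕ)
    (k : Fin d → Fin (2 ^ j)) :
    ∫ x, spaceBasis φ ψ (.wavelet j e k) x * spaceBasis φ ψ (.wavelet j e k) x
      ∂spaceMeasure d = 1 := by
  simp only [he.spaceBasis_eq]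
  rw [integral_prod_mul_prod]
  simp [h.per_wavelet_mul_wavelet]

/-- One vanishing factor suffices. At equal levels it comes from a differing position or from a `φ`
factor. At different levels a `ψ` factor of the other function must be used, since `φ` at a finer
level need not be orthogonal to `ψ` at level `j`; this is where `e' ≠ 0` enters. -/
lemma IsWaveletSystem.integral_full_mul_of_ne (h : IsWaveletSystem τ φ ψ)
    {e : {e : Fin d → Bool // ∃ i, e i = true}} (he : IsFull e) (j : ℕ)
    (k : Fin d → Fin (2 ^ j)) {i : SpaceIndex d} (hi : i ≠ .wavelet j e k) :
    ∫ x, spaceBasis φ ψ (.wavelet j e k) x * spaceBasis φ ψ i x ∂spaceMeasure d = 0 := by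
  obtain ⟨n, -⟩ := e.2
  have hcomm : ∀ {j' : ℕ} {l : ℤ} {n : Fin d}, j' ≤ j → ∫ x in Icc (0 : ℝ) 1,
      perAtom ψ j (k n : ℕ) x * perAtom φ j' l x = 0 := fun hj => by
    simp only [mul_comm (perAtom ψ j _ _)]
    exact h.per_scaling_mul_wavelet hj _ _
  simp only [he.spaceBasis_eq]
  cases i with
  | scaling =>
    simp only [spaceBasis]
    rw [integral_prod_mul_prod]
    exact Finset.prod_eq_zero (Finset.mem_univ n) (hcomm (Nat.zero_le _))
  | wavelet j' e' k' =>
    simp only [spaceBasis]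
    rw [integral_prod_mul_prod fun i => perAtom ψ j (k i : ℕ)]
    by_cases hj : j = j'
    · subst hj
      by_cases hfull : IsFull e'
      · have hee : e' = e := Subtype.ext (funext fun i => by rw [hfull i, he i])
        obtain ⟨n', hn'⟩ : ∃ n', k n' ≠ k' n' := by
          by_contra hall
          push Not at hall
          exact hi (by rw [hee, funext hall])
        refine Finset.prod_eq_zero (Finset.mem_univ n') ?_
        rw [if_pos (hfull n'), h.per_wavelet_mul_wavelet, if_neg hn']
      · obtain ⟨n', hn'⟩ := not_forall.1 hfull
        refine Finset.prod_eq_zero (Finset.mem_univ n') ?_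
        rw [if_neg hn']
        exact hcomm le_rfl
    · obtain ⟨n', hn'⟩ := e'.2
      refine Finset.prod_eq_zero (Finset.mem_univ n') ?_
      rw [if_pos hn']
      exact h.per_wavelet_mul_wavelet_of_ne hj _ _

lemma IsWaveletSystem.integral_time_mul_self (h : IsWaveletSystem τ φ ψ) (m : ℕ)
    (l : Fin (2 ^ m)) : ∫ t in Icc (0 : ℝ) 1,
      timeBasis φ ψ (.wavelet m l) t * timeBasis φ ψ (.wavelet m l) t = 1 := by
  simp [timeBasis, h.per_wavelet_mul_wavelet]

lemma IsWaveletSystem.integral_time_mul_of_ne (h : IsWaveletSystem τ φ ψ) (m : ℕ)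
    (l : Fin (2 ^ m)) {i : TimeIndex} (hi : i ≠ .wavelet m l) : ∫ t in Icc (0 : ℝ) 1,
      timeBasis φ ψ (.wavelet m l) t * timeBasis φ ψ i t = 0 := by
  cases i with
  | scaling =>
    simp only [timeBasis, mul_comm (perAtom ψ m _ _)]
    exact h.per_scaling_mul_wavelet (Nat.zero_le _) _ _
  | wavelet m' l' =>
    simp only [timeBasis]
    by_cases hm : m = m'
    · subst hm
      rw [h.per_wavelet_mul_wavelet, if_neg]
      rintro rfl
      exact hi rfl
    · exact h.per_wavelet_mul_wavelet_of_ne hm _ _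

lemma IsWaveletSystem.continuous_spaceBasis (h : IsWaveletSystem τ φ ψ) (i : SpaceIndex d) :
    Continuous (spaceBasis φ ψ i) := by
  cases i with
  | scaling =>
    refine continuous_finsetProd _ fun n _ => ?_
    exact (continuous_perAtom h.continuous_scaling h.compact_scaling 0 0).comp
      (continuous_apply n)
  | wavelet j e k =>
    refine continuous_finsetProd _ fun n _ => ?_
    split_ifs
    · exact (continuous_perAtom h.continuous_wavelet h.compact_wavelet j _).comp
        (continuous_apply n)
    · exact (continuous_perAtom h.continuous_scaling h.compact_scaling j _).comp
        (continuous_apply n)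

lemma IsWaveletSystem.continuous_timeBasis (h : IsWaveletSystem τ φ ψ) (i : TimeIndex) :
    Continuous (timeBasis φ ψ i) := by
  cases i with
  | scaling => exact continuous_perAtom h.continuous_scaling h.compact_scaling 0 0
  | wavelet m l => exact continuous_perAtom h.continuous_wavelet h.compact_wavelet m _

end Orthogonality

/-! ### Integrability of continuous functions on the unit cube. -/

lemma integrable_spaceMeasure_of_continuous {d : ℕ} {f : (Fin d → ℝ) → ℝ} (hf : Continuous f) :
    Integrable f (spaceMeasure d) := hf.continuousOn.integrableOn_compact isCompact_Icc

lemma integrable_spaceTimeMeasure_of_continuous {d : ℕ} {f : ℝ × (Fin d → ℝ) → ℝ}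
    (hf : Continuous f) : Integrable f (spaceTimeMeasure d) :=
  hf.continuousOn.integrableOn_compact (isCompact_Icc.prod isCompact_Icc)

lemma memLp_spaceMeasure_of_continuous {d : ℕ} {f : (Fin d → ℝ) → ℝ} (hf : Continuous f) :
    MemLp f 2 (spaceMeasure d) :=
  (memLp_two_iff_integrable_sq hf.aestronglyMeasurable).2
    (integrable_spaceMeasure_of_continuous (hf.pow 2))

lemma memLp_spaceTimeMeasure_of_continuous {d : ℕ} {f : ℝ × (Fin d → ℝ) → ℝ}
    (hf : Continuous f) : MemLp f 2 (spaceTimeMeasure d) :=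
  (memLp_two_iff_integrable_sq hf.aestronglyMeasurable).2
    (integrable_spaceTimeMeasure_of_continuous (hf.pow 2))

/-! ### Besov norms of coefficients at a single level -/

lemma seqNorm_eq_of_single {ι : Type*} {q : ℝ≥0∞} (hq : 1 ≤ q) {a : ι → ℝ≥0∞} {i₀ : ι}
    (ha : ∀ i, i ≠ i₀ → a i = 0) : seqNorm q a = a i₀ := by
  unfold seqNorm
  split_ifs with hq'
  · refine le_antisymm (iSup_le fun i => ?_) (le_iSup a i₀)
    by_cases h : i = i₀
    · rw [h]
    · simp [ha i h]
  · have hpos : 0 < q.toReal := ENNReal.toReal_pos (by positivity) hq'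
    rw [tsum_eq_single i₀ fun i hi => by rw [ha i hi, ENNReal.zero_rpow_of_pos hpos],
      ENNReal.rpow_rpow_inv hpos.ne']

lemma seqNorm_le_card_mul {ι : Type*} {p : ℝ≥0∞} (hp : 1 ≤ p) {a : ι → ℝ≥0∞} {T : Finset ι}
    (hT : ∀ i ∉ T, a i = 0) {b : ℝ≥0∞} (hb : ∀ i, a i ≤ b) {N : ℝ≥0∞} (hN : (T.card : ℝ≥0∞) ≤ N) :
    seqNorm p a ≤ N ^ (p⁻¹).toReal * b := by
  unfold seqNorm
  split_ifs with hp'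
  · simpa [hp'] using hb
  · have hpos : 0 < p.toReal := ENNReal.toReal_pos (by positivity) hp'
    rw [tsum_eq_sum (s := T) fun i hi => by rw [hT i hi, ENNReal.zero_rpow_of_pos hpos],
      ENNReal.toReal_inv]
    calc (∑ i ∈ T, a i ^ p.toReal) ^ p.toReal⁻¹
        ≤ (N * b ^ p.toReal) ^ p.toReal⁻¹ := by
          refine ENNReal.rpow_le_rpow ?_ (by positivity)
          refine (Finset.sum_le_sum fun i _ => ENNReal.rpow_le_rpow (hb i) hpos.le).trans ?_
          rw [Finset.sum_const, nsmul_eq_mul]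
          gcongr
      _ = _ := by
          rw [ENNReal.mul_rpow_of_nonneg _ _ (by positivity), ENNReal.rpow_rpow_inv hpos.ne']

/-- The Besov norm of a family with at most `2^{jd}` nonzero members, all at level `j`. -/
lemma besovNorm_le_of_single_level {ι : Type*} {level : ι → ℤ} {d : ℕ} {s : ℝ} {p q : ℝ≥0∞}
    (hp : 1 ≤ p) (hq : 1 ≤ q) {a : ι → ℝ} {T : Finset ι} {j : ℕ} (hT : ∀ i ∉ T, a i = 0)
    (hlev : ∀ i ∈ T, level i = j) (hcard : T.card ≤ 2 ^ (j * d)) {b : ℝ}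
    (hb : ∀ i, |a i| ≤ b) :
    besovNorm level d s p q a ≤ ENNReal.ofReal ((2 : ℝ) ^ ((j : ℝ) * (s + d / 2)) * b) := by
  unfold besovNorm
  -- Level `j` sits at index `j + 1`, as `n` stands for level `n - 1`.
  rw [seqNorm_eq_of_single hq (i₀ := j + 1)]
  · classical
    have h1 : seqNorm p (fun i : {i : ι // level i = ((j + 1 : ℕ) : ℤ) - 1} => ‖a i.1‖ₑ) ≤
        (ENNReal.ofReal ((2 : ℝ) ^ ((j : ℝ) * d))) ^ (p⁻¹).toReal * ENNReal.ofReal b := by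
      refine seqNorm_le_card_mul hp (T := T.subtype _) (fun i hi => ?_) (fun i => ?_) ?_
      · rw [hT i.1 (by simpa using hi), enorm_zero]
      · rw [Real.enorm_eq_ofReal_abs]
        exact ENNReal.ofReal_le_ofReal (hb i.1)
      · have hc : (T.subtype fun i => level i = ((j + 1 : ℕ) : ℤ) - 1).card ≤ 2 ^ (j * d) := by
          rw [Finset.card_subtype]
          exact (Finset.card_filter_le _ _).trans hcard
        have e : ENNReal.ofReal ((2 : ℝ) ^ ((j : ℝ) * d)) = ((2 ^ (j * d) : ℕ) : ℝ≥0∞) := by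
          rw [← ENNReal.ofReal_natCast]
          congr 1
          rw [← Nat.cast_mul, Real.rpow_natCast]
          push_cast
          rfl
        rw [e]
        exact_mod_cast hc
    refine (mul_le_mul_right h1 _).trans (le_of_eq ?_)
    -- The cardinality contributes `2^{jd/p}`, which cancels the `-d/p` in the Besov weight.
    rw [ENNReal.ofReal_rpow_of_pos (by positivity), ← mul_assoc,
      ← ENNReal.ofReal_mul (by positivity), ← ENNReal.ofReal_mul (by positivity),
      ← Real.rpow_mul two_pos.le, ← Real.rpow_add two_pos]
    congr 3
    push_cast
    ring
  · intro n hn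
    have hz : (fun i : {i : ι // level i = (n : ℤ) - 1} => ‖a i.1‖ₑ) = fun _ => 0 := by
      funext i
      rw [hT i.1, enorm_zero]
      intro hi
      have h1 := hlev i.1 hi
      have h2 := i.2
      omega
    rw [hz]
    have : seqNorm p (fun _ : {i : ι // level i = (n : ℤ) - 1} => (0 : ℝ≥0∞)) ≤ 0 := by
      have := seqNorm_le_card_mul hp (T := (∅ : Finset {i : ι // level i = (n : ℤ) - 1}))
        (a := fun _ => 0) (b := 0) (N := 0) (fun _ _ => rfl) (fun _ => le_rfl) (by simp)
      simpa using this
    rw [nonpos_iff_eq_zero.1 this, mul_zero]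

/-! ### Tensor-product wavelets of one level in space and one level in time -/

section Hypercube

variable {d τ₁ τ₂ : ℕ} {φ ψ φ' ψ' : ℝ → ℝ}

/-- The product of a temporal wavelet at level `m` and a spatial wavelet at level `j`. -/
noncomputable def productWavelet (φ ψ φ' ψ' : ℝ → ℝ) (j m : ℕ)
    (e : {e : Fin d → Bool // ∃ i, e i = true})
    (p : (Fin d → Fin (2 ^ j)) × Fin (2 ^ m)) (z : ℝ × (Fin d → ℝ)) : ℝ :=
  timeBasis φ' ψ' (.wavelet m p.2) z.1 * spaceBasis φ ψ (.wavelet j e p.1) z.2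

variable {j m : ℕ} {e : {e : Fin d → Bool // ∃ i, e i = true}}

lemma continuous_productWavelet (hspace : IsWaveletSystem τ₁ φ ψ)
    (htime : IsWaveletSystem τ₂ φ' ψ') (p : (Fin d → Fin (2 ^ j)) × Fin (2 ^ m)) :
    Continuous (productWavelet φ ψ φ' ψ' j m e p) :=
  ((htime.continuous_timeBasis _).comp continuous_fst).mul
    ((hspace.continuous_spaceBasis _).comp continuous_snd)

lemma integral_productWavelet_mul (i : SpaceIndex d) (k : TimeIndex)
    (p : (Fin d → Fin (2 ^ j)) × Fin (2 ^ m)) :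
    ∫ z, productWavelet φ ψ φ' ψ' j m e p z * timeBasis φ' ψ' k z.1 * spaceBasis φ ψ i z.2
      ∂spaceTimeMeasure d =
    (∫ t in Icc (0 : ℝ) 1, timeBasis φ' ψ' (.wavelet m p.2) t * timeBasis φ' ψ' k t) *
      ∫ x, spaceBasis φ ψ (.wavelet j e p.1) x * spaceBasis φ ψ i x ∂spaceMeasure d := by
  rw [spaceTimeMeasure_eq_prod, ← integral_prod_mul]
  refine integral_congr_ae (ae_of_all _ fun z => ?_)
  simp only [productWavelet]
  ring

lemma productWavelet_orthonormal (hspace : IsWaveletSystem τ₁ φ ψ)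
    (htime : IsWaveletSystem τ₂ φ' ψ') (he : IsFull e)
    (p r : (Fin d → Fin (2 ^ j)) × Fin (2 ^ m)) :
    ∫ z, productWavelet φ ψ φ' ψ' j m e p z * productWavelet φ ψ φ' ψ' j m e r z
      ∂spaceTimeMeasure d = if p = r then 1 else 0 := by
  have h1 := integral_productWavelet_mul (φ := φ) (ψ := ψ) (φ' := φ') (ψ' := ψ') (e := e)
    (.wavelet j e r.1) (.wavelet m r.2) p
  simp only [mul_assoc] at h1
  rw [show (∫ z, productWavelet φ ψ φ' ψ' j m e p z * productWavelet φ ψ φ' ψ' j m e r z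
      ∂spaceTimeMeasure d) = _ from h1]
  split_ifs with hpr
  · subst hpr
    rw [htime.integral_time_mul_self, hspace.integral_full_mul_self he, one_mul]
  · by_cases h2 : p.2 = r.2
    · have h3 : r.1 ≠ p.1 := fun h => hpr (Prod.ext h.symm h2)
      rw [hspace.integral_full_mul_of_ne he _ _ (by simpa using h3), mul_zero]
    · rw [htime.integral_time_mul_of_ne _ _ (by simpa using Ne.symm h2), zero_mul]

variable (c : (Fin d → Fin (2 ^ j)) × Fin (2 ^ m) → ℝ)

lemma spaceCoeff_sum (hspace : IsWaveletSystem τ₁ φ ψ) (i : SpaceIndex d) (t : ℝ) :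
    spaceCoeff φ ψ (fun z => ∑ p, c p * productWavelet φ ψ φ' ψ' j m e p z) t i =
      ∑ k, (∑ l, c (k, l) * perAtom ψ' m (l : ℕ) t) *
        ∫ x, spaceBasis φ ψ (.wavelet j e k) x * spaceBasis φ ψ i x ∂spaceMeasure d := by
  simp only [spaceCoeff, Finset.sum_mul]
  rw [integral_finsetSum, Fintype.sum_prod_type]
  · refine Finset.sum_congr rfl fun k _ => Finset.sum_congr rfl fun l _ => ?_
    rw [← integral_const_mul]
    refine integral_congr_ae (ae_of_all _ fun x => ?_)
    simp only [productWavelet, timeBasis]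
    ring
  · intro p _
    refine integrable_spaceMeasure_of_continuous ?_
    have h1 := hspace.continuous_spaceBasis i
    have h2 := hspace.continuous_spaceBasis (.wavelet j e p.1)
    simp only [productWavelet]
    fun_prop

lemma spaceTimeCoeff_sum (hspace : IsWaveletSystem τ₁ φ ψ) (htime : IsWaveletSystem τ₂ φ' ψ')
    (i : SpaceIndex d) (k : TimeIndex) :
    spaceTimeCoeff φ ψ φ' ψ' (fun z => ∑ p, c p * productWavelet φ ψ φ' ψ' j m e p z) i k =
      ∑ p, c p * ((∫ t in Icc (0 : ℝ) 1,
          timeBasis φ' ψ' (.wavelet m p.2) t * timeBasis φ' ψ' k t) *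
        ∫ x, spaceBasis φ ψ (.wavelet j e p.1) x * spaceBasis φ ψ i x ∂spaceMeasure d) := by
  simp only [spaceTimeCoeff, Finset.sum_mul]
  rw [integral_finsetSum]
  · refine Finset.sum_congr rfl fun p _ => ?_
    rw [← integral_productWavelet_mul, ← integral_const_mul]
    refine integral_congr_ae (ae_of_all _ fun x => ?_)
    simp only
    ring
  · intro p _
    refine integrable_spaceTimeMeasure_of_continuous ?_
    have h1 := hspace.continuous_spaceBasis i
    have h2 := htime.continuous_timeBasis k
    have h3 := continuous_productWavelet (e := e) hspace htime p
    fun_prop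

/-- Sums of product wavelets with small coefficients belong to the space-time Besov ball. -/
lemma sum_productWavelet_mem_besovBall (hspace : IsWaveletSystem τ₁ φ ψ)
    (htime : IsWaveletSystem τ₂ φ' ψ') (he : IsFull e) {s₁ s₂ : ℝ} {p₁ q₁ p₂ q₂ : ℝ≥0∞}
    (hp₁ : 1 ≤ p₁) (hq₁ : 1 ≤ q₁) (hp₂ : 1 ≤ p₂) (hq₂ : 1 ≤ q₂) {A₁ : ℝ} {Arad : SpaceIndex d → ℝ}
    (hArad : ∀ i, 0 < Arad i) {K γ : ℝ} (hγ : 0 ≤ γ)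
    (hK : ∀ t, ∑ l : Fin (2 ^ m), |perAtom ψ' m (l : ℕ) t| ≤ K * (2 : ℝ) ^ ((m : ℝ) / 2))
    (hc : ∀ p, |c p| ≤ γ)
    (h₁ : (2 : ℝ) ^ ((j : ℝ) * (s₁ + d / 2)) * (γ * (K * (2 : ℝ) ^ ((m : ℝ) / 2))) ≤ A₁)
    (h₂ : ∀ k, (2 : ℝ) ^ ((m : ℝ) * (s₂ + 1 / 2)) * γ ≤ Arad (.wavelet j e k)) :
    (fun z => ∑ p, c p * productWavelet φ ψ φ' ψ' j m e p z) ∈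
      besovBall d φ ψ φ' ψ' s₁ s₂ p₁ q₁ p₂ q₂ A₁ Arad := by
  have hcont : Continuous fun z => ∑ p, c p * productWavelet φ ψ φ' ψ' j m e p z :=
    continuous_finsetSum _ fun p _ => (continuous_productWavelet hspace htime p).const_mul _
  have hinj : Function.Injective fun k : Fin d → Fin (2 ^ j) => SpaceIndex.wavelet j e k :=
    fun k k' h => by simpa using h
  have hinj' : Function.Injective fun l : Fin (2 ^ m) => TimeIndex.wavelet m l :=
    fun k k' h => by simpa using h
  refine ⟨memLp_spaceTimeMeasure_of_continuous hcont, fun t _ => ⟨?_, ?_⟩, fun i => ?_⟩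
  · exact memLp_spaceMeasure_of_continuous (hcont.comp (Continuous.prodMk_right t))
  · refine (besovNorm_le_of_single_level hp₁ hq₁ (T := Finset.univ.map ⟨_, hinj⟩) (j := j)
      (b := γ * (K * (2 : ℝ) ^ ((m : ℝ) / 2))) (fun i hi => ?_) (fun i hi => ?_) ?_
      fun i => ?_).trans (ENNReal.ofReal_le_ofReal h₁)
    · rw [spaceCoeff_sum c hspace]
      refine Finset.sum_eq_zero fun k _ => ?_
      rw [hspace.integral_full_mul_of_ne he, mul_zero]
      rintro rfl
      exact hi (by simp)
    · obtain ⟨k, -, rfl⟩ := Finset.mem_map.1 hi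
      rfl
    · rw [Finset.card_map, Finset.card_univ, Fintype.card_fun, Fintype.card_fin, Fintype.card_fin,
        pow_mul]
    · have hK0 : 0 ≤ K * (2 : ℝ) ^ ((m : ℝ) / 2) :=
        (Finset.sum_nonneg fun _ _ => abs_nonneg _).trans (hK 0)
      rw [spaceCoeff_sum c hspace]
      by_cases hi : ∃ k, i = .wavelet j e k
      · obtain ⟨k, rfl⟩ := hi
        rw [Finset.sum_eq_single k (fun k' _ hk' => by
          rw [hspace.integral_full_mul_of_ne he _ _ (hinj.ne hk'.symm), mul_zero])
          (fun h => absurd (Finset.mem_univ k) h), hspace.integral_full_mul_self he, mul_one]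
        -- The remaining coefficient is a combination of the temporal wavelets at time `t`; `hK`
        -- bounds their absolute sum by order `2^{m/2}`, although there are `2^m` of them.
        refine (Finset.abs_sum_le_sum_abs _ _).trans ?_
        refine le_trans (Finset.sum_le_sum fun l _ => ?_)
          (le_of_eq_of_le (Finset.mul_sum _ _ _).symm (mul_le_mul_of_nonneg_left (hK t) hγ))
        rw [abs_mul]
        exact mul_le_mul_of_nonneg_right (hc _) (abs_nonneg _)
      · rw [Finset.sum_eq_zero fun k _ => ?_]
        · simpa using mul_nonneg hγ hK0
        · rw [hspace.integral_full_mul_of_ne he _ _ fun h => hi ⟨k, h⟩, mul_zero]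
  · by_cases hi : ∃ k, i = .wavelet j e k
    · obtain ⟨k, rfl⟩ := hi
      refine (besovNorm_le_of_single_level hp₂ hq₂ (T := Finset.univ.map ⟨_, hinj'⟩) (j := m)
        (b := γ) (fun i hi => ?_) (fun i hi => ?_) ?_ fun i => ?_).trans
        (ENNReal.ofReal_le_ofReal (by simpa using h₂ k))
      · rw [spaceTimeCoeff_sum c hspace htime]
        refine Finset.sum_eq_zero fun p _ => ?_
        rw [htime.integral_time_mul_of_ne, zero_mul, mul_zero]
        rintro rfl
        exact hi (by simp)
      · obtain ⟨k, -, rfl⟩ := Finset.mem_map.1 hi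
        rfl
      · simp
      · rw [spaceTimeCoeff_sum c hspace htime]
        by_cases hl : ∃ l, i = .wavelet m l
        · obtain ⟨l, rfl⟩ := hl
          rw [Finset.sum_eq_single (k, l) (fun p _ hp => ?_)
            (fun h => absurd (Finset.mem_univ _) h), hspace.integral_full_mul_self he,
            htime.integral_time_mul_self, mul_one, mul_one]
          · exact hc _
          · by_cases h1 : p.1 = k
            · have h2 : p.2 ≠ l := fun h => hp (Prod.ext h1 h)
              rw [htime.integral_time_mul_of_ne _ _ (hinj'.ne h2.symm), zero_mul, mul_zero]
            · rw [hspace.integral_full_mul_of_ne he _ _ (hinj.ne (Ne.symm h1)), mul_zero, mul_zero]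
        · rw [Finset.sum_eq_zero fun p _ => ?_]
          · simpa using hγ
          · rw [htime.integral_time_mul_of_ne _ _ fun h => hl ⟨p.2, h⟩, zero_mul, mul_zero]
    · have hz : ∀ k, spaceTimeCoeff φ ψ φ' ψ'
          (fun z => ∑ p, c p * productWavelet φ ψ φ' ψ' j m e p z) i k = 0 := fun k => by
        rw [spaceTimeCoeff_sum c hspace htime]
        refine Finset.sum_eq_zero fun p _ => ?_
        rw [hspace.integral_full_mul_of_ne he _ _ fun h => hi ⟨p.1, h⟩, mul_zero, mul_zero]
      refine (besovNorm_le_of_single_level hp₂ hq₂ (T := ∅) (j := m) (b := 0) (fun k _ => hz k)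
        (by simp) (by simp) fun k => by rw [hz, abs_zero]).trans (ENNReal.ofReal_le_ofReal (by
          simpa using (hArad i).le))

end Hypercube

/-- The choice of the resolution levels that balances the smoothness constraints and the noise
level `ε = 2^E`; here `2^{-L}` is the square root of the rate. -/
lemma exists_balanced_levels {d : ℕ} {s₁ s₂ s : ℝ} (hs₁ : 0 < s₁) (hs₂ : 0 < s₂) (hs : 0 < s)
    (hsdef : 1 / s = 1 / ((d : ℝ) + 1) * (d / s₁ + 1 / s₂)) {E L : ℝ} (hE : E ≤ 0)
    (hL : L = -(2 * s / (2 * s + d + 1)) * E) :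
    ∃ j m : ℕ, j * (s₁ + d / 2) + m / 2 + E ≤ 0 ∧ m * (s₂ + 1 / 2) + d / 2 * j + E ≤ 0 ∧
      -(2 * L) ≤ 2 * E + (j * d + m) + (d + 1) := by
  have hL0 : 0 ≤ L := by
    rw [hL]
    have : 0 ≤ 2 * s / (2 * s + d + 1) := by positivity
    nlinarith
  have hx0 : 0 ≤ L / s₁ := by positivity
  have hy0 : 0 ≤ L / s₂ := by positivity
  -- This identity is what the choice of `L` achieves: it makes both constraints tight at the
  -- real-valued levels `L / s₁` and `L / s₂`.
  have hsum : d * (L / s₁) + L / s₂ = -2 * E - 2 * L := by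
    have h1 : d * (L / s₁) + L / s₂ = L * (d / s₁ + 1 / s₂) := by ring
    have h2 : (d : ℝ) / s₁ + 1 / s₂ = (d + 1) / s := by
      have h3 : ((d : ℝ) + 1) ≠ 0 := by positivity
      calc (d : ℝ) / s₁ + 1 / s₂ = (d + 1) * (1 / (d + 1) * (d / s₁ + 1 / s₂)) := by
            rw [← mul_assoc, mul_one_div_cancel h3, one_mul]
        _ = _ := by rw [← hsdef]; ring
    have h4 : (2 * s + d + 1) ≠ 0 := by positivity
    rw [h1, h2, hL]
    field_simp
    ring
  have hj := Nat.floor_le hx0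
  have hj' := Nat.lt_floor_add_one (L / s₁)
  have hm := Nat.floor_le hy0
  have hm' := Nat.lt_floor_add_one (L / s₂)
  -- Rounding down preserves the two constraints and lowers `jd + m` by at most `d + 1`.
  refine ⟨⌊L / s₁⌋₊, ⌊L / s₂⌋₊, ?_⟩
  generalize (⌊L / s₁⌋₊ : ℝ) = j at *
  generalize (⌊L / s₂⌋₊ : ℝ) = m at *
  have hd : (0 : ℝ) ≤ d := Nat.cast_nonneg d
  have hjs : j * s₁ ≤ L := (le_div_iff₀ hs₁).1 hj
  have hms : m * s₂ ≤ L := (le_div_iff₀ hs₂).1 hm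
  have hdj : d * j ≤ d * (L / s₁) := mul_le_mul_of_nonneg_left hj hd
  have hdj' : d * (L / s₁) ≤ d * (j + 1) := mul_le_mul_of_nonneg_left hj'.le hd
  refine ⟨?_, ?_, ?_⟩ <;> linarith

end SpaceTimeWavelet

/-! ### The minimax lower bound. -/

theorem theorem1 (d : ℕ) (hd : 1 ≤ d)
    (τ₁ τ₂ : ℕ) (φ ψ φ' ψ' : ℝ → ℝ)
    (hspace : SpaceTimeWavelet.IsWaveletSystem τ₁ φ ψ)
    (htime : SpaceTimeWavelet.IsWaveletSystem τ₂ φ' ψ')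
    (A₁ : ℝ) (hA₁ : 0 < A₁)
    (Arad : SpaceTimeWavelet.SpaceIndex d → ℝ) (hArad : ∀ i, 0 < Arad i)
    (hlow : ∃ A : ℝ, 0 < A ∧ ∀ i : SpaceTimeWavelet.SpaceIndex d,
      A ≤ Arad i * (2 : ℝ) ^ ((d : ℝ) / 2 * ((i.level : ℝ) + 1)))
    (s₁ s₂ : ℝ) (hs₁ : 0 < s₁) (hs₁τ : s₁ < τ₁) (hs₂ : 0 < s₂) (hs₂τ : s₂ < τ₂)
    (p₁ q₁ p₂ q₂ : ℝ≥0∞) (hp₁ : 1 ≤ p₁) (hq₁ : 1 ≤ q₁) (hp₂ : 1 ≤ p₂) (hq₂ : 1 ≤ q₂)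
    (hsp₁ : 0 < s₁ + d * (1 / 2 - (p₁⁻¹).toReal))
    (hsp₂ : 0 < s₂ + 1 / 2 - (p₂⁻¹).toReal)
    (s : ℝ) (hs : 0 < s) (hsdef : 1 / s = 1 / ((d : ℝ) + 1) * (d / s₁ + 1 / s₂)) :
    ∃ C : ℝ, 0 < C ∧ ∃ ε₀ : ℝ, 0 < ε₀ ∧
      ∀ {Ω : Type*} [MeasurableSpace Ω] (P : Measure Ω) [IsProbabilityMeasure P]
        (W : Lp ℝ 2 (SpaceTimeWavelet.spaceTimeMeasure d) → Ω → ℝ),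
        SpaceTimeWavelet.IsWhiteNoise P d W →
        ∀ ε : ℝ, 0 < ε → ε < ε₀ →
          ENNReal.ofReal (C * ε ^ (4 * s / (2 * s + d + 1))) ≤
            SpaceTimeWavelet.minimaxRisk P W ε
              (SpaceTimeWavelet.besovBall d φ ψ φ' ψ' s₁ s₂ p₁ q₁ p₂ q₂ A₁ Arad) := by
  open SpaceTimeWavelet in
  obtain ⟨A, hA, hlow⟩ := hlow
  obtain ⟨K, hK0, hK⟩ := exists_sum_abs_perAtom_le htime.continuous_wavelet htime.compact_wavelet
  -- The three bounds on `c` serve `γ ≤ ε`, the spatial radius, and the temporal radii; `2^{-d/2}`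
  -- absorbs the `+1` in `2^{d(j+1)/2}`.
  set c : ℝ := min 1 (min (A₁ / K) (A * (2 : ℝ) ^ (-(d : ℝ) / 2))) with hcdef
  have hc0 : 0 < c := by positivity
  have hc1 : c ≤ 1 := min_le_left _ _
  have hcK : c * K ≤ A₁ :=
    (le_div_iff₀ hK0).1 ((min_le_right _ _).trans (min_le_left _ _))
  have hcA : c ≤ A * (2 : ℝ) ^ (-(d : ℝ) / 2) := (min_le_right _ _).trans (min_le_right _ _)
  have hfloor := gaussianFloor_pos
  -- The factor `2^{-(d+1)}` pays for rounding the levels; `ε < 1` ensures `E ≤ 0`, hence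
  -- nonnegative levels.
  refine ⟨gaussianFloor / 4 * c ^ 2 * (2 : ℝ) ^ (-((d : ℝ) + 1)), by positivity, 1, one_pos, ?_⟩
  intro Ω _ P _ W hW ε hε hε1
  set E := Real.logb 2 ε with hEdef
  have hεE : (2 : ℝ) ^ E = ε := Real.rpow_logb two_pos (by norm_num) hε
  have hE0 : E ≤ 0 := (Real.logb_neg one_lt_two hε hε1).le
  obtain ⟨j, m, hjm₁, hjm₂, hjm₃⟩ := exists_balanced_levels hs₁ hs₂ hs hsdef hE0 rfl
  let e : {e : Fin d → Bool // ∃ i, e i = true} := ⟨fun _ => true, ⟨⟨0, hd⟩, rfl⟩⟩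
  have he : IsFull e := fun _ => rfl
  have hpow : ∀ {x : ℝ}, x ≤ 0 → (2 : ℝ) ^ x ≤ 1 := fun hx =>
    Real.rpow_le_one_of_one_le_of_nonpos one_le_two hx
  have h₁ : (2 : ℝ) ^ ((j : ℝ) * (s₁ + d / 2)) * (c * ε * (K * (2 : ℝ) ^ ((m : ℝ) / 2))) ≤ A₁ := by
    calc (2 : ℝ) ^ ((j : ℝ) * (s₁ + d / 2)) * (c * ε * (K * (2 : ℝ) ^ ((m : ℝ) / 2)))
        = c * K * (2 : ℝ) ^ (j * (s₁ + d / 2) + m / 2 + E) := by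
          rw [Real.rpow_add two_pos, Real.rpow_add two_pos, hεE]; ring
      _ ≤ c * K := mul_le_of_le_one_right (by positivity) (hpow hjm₁)
      _ ≤ A₁ := hcK
  have h₂ : ∀ k, (2 : ℝ) ^ ((m : ℝ) * (s₂ + 1 / 2)) * (c * ε) ≤ Arad (.wavelet j e k) := by
    intro k
    have hk : A ≤ Arad (.wavelet j e k) * (2 : ℝ) ^ ((d : ℝ) / 2 * ((j : ℝ) + 1)) := by
      simpa [SpaceIndex.level] using hlow (.wavelet j e k)
    calc (2 : ℝ) ^ ((m : ℝ) * (s₂ + 1 / 2)) * (c * ε)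
        = c * (2 : ℝ) ^ (m * (s₂ + 1 / 2) + d / 2 * j + E) * (2 : ℝ) ^ (-((d : ℝ) / 2 * j)) := by
          rw [mul_assoc, ← Real.rpow_add two_pos, ← hεE,
            show m * (s₂ + 1 / 2) + d / 2 * j + E + -((d : ℝ) / 2 * j) =
              m * (s₂ + 1 / 2) + E by ring, Real.rpow_add two_pos]
          ring
      _ ≤ c * (2 : ℝ) ^ (-((d : ℝ) / 2 * j)) :=
          mul_le_mul_of_nonneg_right (mul_le_of_le_one_right hc0.le (hpow hjm₂)) (by positivity)
      _ ≤ A * (2 : ℝ) ^ (-(d : ℝ) / 2) * (2 : ℝ) ^ (-((d : ℝ) / 2 * j)) :=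
          mul_le_mul_of_nonneg_right hcA (by positivity)
      _ = A * (2 : ℝ) ^ (-((d : ℝ) / 2 * ((j : ℝ) + 1))) := by
          rw [mul_assoc, ← Real.rpow_add two_pos]
          ring_nf
      _ ≤ Arad (.wavelet j e k) * (2 : ℝ) ^ ((d : ℝ) / 2 * ((j : ℝ) + 1)) *
            (2 : ℝ) ^ (-((d : ℝ) / 2 * ((j : ℝ) + 1))) :=
          mul_le_mul_of_nonneg_right hk (by positivity)
      _ = Arad (.wavelet j e k) := by
          rw [mul_assoc, ← Real.rpow_add two_pos, add_neg_cancel, Real.rpow_zero, mul_one]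
  have hcε : 0 ≤ c * ε := by positivity
  have key := hW.hypercube_le_minimaxRisk
    (h := productWavelet φ ψ φ' ψ' j m e)
    (B := besovBall d φ ψ φ' ψ' s₁ s₂ p₁ q₁ p₂ q₂ A₁ Arad)
    (fun p => memLp_spaceTimeMeasure_of_continuous (continuous_productWavelet hspace htime p))
    (fun p => (continuous_productWavelet hspace htime p).measurable)
    (productWavelet_orthonormal hspace htime he) hε hcε
    (mul_le_of_le_one_left hε.le hc1) fun θ =>
      sum_productWavelet_mem_besovBall _ hspace htime he hp₁ hq₁ hp₂ hq₂ hArad hcε (hK m)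
        (fun p => by split_ifs <;> simp [abs_of_nonneg hcε, hcε]) h₁ h₂
  refine le_trans (ENNReal.ofReal_le_ofReal ?_) key
  have hcard : (Fintype.card ((Fin d → Fin (2 ^ j)) × Fin (2 ^ m)) : ℝ) =
      (2 : ℝ) ^ ((j : ℝ) * d + m) := by
    rw [Fintype.card_prod, Fintype.card_fun, Fintype.card_fin, Fintype.card_fin, Fintype.card_fin,
      Real.rpow_add two_pos, ← Nat.cast_mul, Real.rpow_natCast, Real.rpow_natCast, pow_mul]
    push_cast
    rfl
  have hrate : ε ^ (4 * s / (2 * s + d + 1)) =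
      (2 : ℝ) ^ (-(2 * (-(2 * s / (2 * s + d + 1)) * E))) := by
    rw [← hεE, ← Real.rpow_mul two_pos.le]
    congr 1
    ring
  have hsq : (c * ε) ^ 2 = c ^ 2 * (2 : ℝ) ^ (2 * E) := by
    rw [mul_pow, two_mul, Real.rpow_add two_pos, hεE]; ring
  rw [hcard, hrate, hsq]
  calc gaussianFloor / 4 * c ^ 2 * (2 : ℝ) ^ (-((d : ℝ) + 1)) *
        (2 : ℝ) ^ (-(2 * (-(2 * s / (2 * s + d + 1)) * E)))
      = gaussianFloor / 4 * c ^ 2 * (2 : ℝ) ^ (-((d : ℝ) + 1) +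
          -(2 * (-(2 * s / (2 * s + d + 1)) * E))) := by rw [Real.rpow_add two_pos]; ring
    _ ≤ gaussianFloor / 4 * c ^ 2 * (2 : ℝ) ^ (2 * E + (j * d + m)) := by
        refine mul_le_mul_of_nonneg_left ?_ (by positivity)
        exact Real.rpow_le_rpow_of_exponent_le one_le_two (by linarith)
    _ = gaussianFloor / 4 * (c ^ 2 * (2 : ℝ) ^ (2 * E)) * (2 : ℝ) ^ ((j : ℝ) * d + m) := by
        rw [Real.rpow_add two_pos]; ring
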